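/- A directed network $G$ on the node set $\{0,\dots,n-1\}$ has a set of directed edges $(u,v)$, each with an arbitrary real weight $w(u,v)$, such that no directed cycle has negative total weight (this includes all non-negative, in particular zero, weights, and undirected networks). Let $\mathrm{dist}_G(u,v)$ be the minimum total weight of a directed path from $u$ to $v$, and $\infty$ if there is none. Consider the following synchronous model (unidirectional broadcast CONGEST with arbitrary weights). All nodes run the same program, with unlimited computational power and private fair coins. Initially a node knows only $n$, its own identifier, and its incoming and outgoing edges (the identifiers of their other endpoints) with their weights. In every round each node sends one and the same message along all its outgoing edges (or stays silent) and receives the messages of its in-neighbours. A message consists of $c\lceil\log_2 n\rceil$ bits and at most one distance value, i.e. a real number that is the length of some directed walk of $G$ with at most $n^c$ edges, where $c$ is a constant. At some point a node $v$ announces its result, a vector $(d^v(u))_{u}$, which is final; it may go on relaying messages afterwards. Let $T$ be the number of rounds until all nodes have announced their results. There are constants $c$ and $k$ and a randomized algorithm (one program for each $n$) in this model that solves exact all-pairs shortest paths in a Las Vegas manner in $\tilde O(n)$ rounds. That is, for every $n$ and every network $G$ on $n$ nodes without negative cycles: (1) whatever the outcome of the coins, a result announced by a node $v$ is correct: $d^v(u)=\mathrm{dist}_G(u,v)$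 for every node $u$; moreover, if $G$ is strongly connected, then, whatever the outcome of the coins, all nodes announce their results in the same round (if ever), so that the computation can stop there; (2) $\mathbb E[T]\le C\,n\,\log^k(n+1)$, where $C$ is a constant; (3) for every $a\in\mathbb N$ there is a constant $C_a$, which does not depend on $n$ and $G$, with $\Pr[T> C_a\, n\,\log^k(n+1)]\le n^{-a}$. -/

import Mathlib

open MeasureTheory
open scoped ENNReal

noncomputable section

/-- A directed network on the nodes `0, …, n - 1` with arbitrary real edge weights. Only the values
of `weight` on edges matter. An undirected network is the case of symmetric `Adj` and `weight`. -/
structure Network (n : ℕ) extends Digraph (Fin n) where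
  weight : Fin n → Fin n → ℝ

namespace Network

variable {n : ℕ} (G : Network n)

/-- `G.HasWalk u v m ℓ`: there is a directed walk from `u` to `v` with `m` edges and total
weight `ℓ`. -/
inductive HasWalk : Fin n → Fin n → ℕ → ℝ → Prop
  | nil (u : Fin n) : HasWalk u u 0 0
  | cons {u x v : Fin n} {m : ℕ} {ℓ : ℝ} :
      G.Adj u x → HasWalk x v m ℓ → HasWalk u v (m + 1) (G.weight u x + ℓ)

/-- No directed cycle (closed walk) has negative total weight. -/
def NoNegativeCycle : Prop :=
  ∀ (u : Fin n) (m : ℕ) (ℓ : ℝ), G.HasWalk u u m ℓ → 0 ≤ ℓ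

/-- The shortest-path distance from `u` to `v`; it is `⊤` if `v` is not reachable from `u`. -/
def dist (u v : Fin n) : EReal :=
  sInf {x : EReal | ∃ (m : ℕ) (ℓ : ℝ), G.HasWalk u v m ℓ ∧ x = (ℓ : EReal)}

/-- Every node is reachable from every node. -/
def StronglyConnected : Prop :=
  ∀ u v : Fin n, ∃ (m : ℕ) (ℓ : ℝ), G.HasWalk u v m ℓ

end Network

/-- What a node knows initially, besides `n`: its own identifier, and its incoming and outgoing
edges (the neighbours at their other ends) with their weights; `none` stands for an absent edge. -/
structure LocalInput (n : ℕ) where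
  id : Fin n
  inEdge : Fin n → Option ℝ
  outEdge : Fin n → Option ℝ

open Classical in
/-- The initial knowledge of the node `v` in the network `G`. -/
def Network.localInput {n : ℕ} (G : Network n) (v : Fin n) : LocalInput n where
  id := v
  inEdge u := if G.Adj u v then some (G.weight u v) else none
  outEdge u := if G.Adj v u then some (G.weight v u) else none

/-- A message consists of a string of `L` bits and at most one real number. The real number is
subject to `NodeProgram.SendsOnlyPathLengths` below. -/
structure Message (L : ℕ) where
  bits : BitVec L
  value : Option ℝ

/-- The program run by every node of a network with `n` nodes, with `L` bits per message.
Nodes have unlimited computational power, so that all the maps are arbitrary. In each round a node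
broadcasts one message (or stays silent), receives the messages of its in-neighbours, tossing
`numCoins` private coins, and changes its state. `output s = some d` means that a node in state `s`
has announced the result `d`, where `d u` is its distance from `u`. An announced result is final
(the node may still relay messages after that). -/
structure NodeProgram (n L : ℕ) where
  State : Type
  numCoins : ℕ
  init : LocalInput n → State
  send : State → Option (Message L)
  step : State → (Fin numCoins → Bool) → (Fin n → Option (Message L)) → State
  output : State → Option (Fin n → EReal)
  output_final : ∀ s coins received d,
    output s = some d → output (step s coins received) = some d

/-- All the coin tosses: `ω (t, v, i)` is the `i`-th coin of the node `v` in round `t`. -/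
abbrev Coins (n : ℕ) : Type := ℕ × Fin n × ℕ → Bool

/-- All coins are fair and independent. -/
def coinMeasure (n : ℕ) : Measure (Coins n) :=
  Measure.infinitePi fun _ => (PMF.uniformOfFintype Bool).toMeasure

namespace NodeProgram

variable {n L : ℕ} (A : NodeProgram n L) (G : Network n)

open Classical in
/-- The state of each node after `t` synchronous rounds. Messages travel only along the edge
directions, and each node sends the same message along all its outgoing edges. -/
def run (ω : Coins n) : ℕ → Fin n → A.State
  | 0 => fun v => A.init (G.localInput v)
  | t + 1 => fun v =>
      A.step (run ω t v) (fun i => ω (t, v, i))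
        (fun u => if G.Adj u v then A.send (run ω t u) else none)

/-- The result announced by `v` within the first `t` rounds, if any. -/
def outputAt (ω : Coins n) (t : ℕ) (v : Fin n) : Option (Fin n → EReal) :=
  A.output (A.run G ω t v)

/-- The number of rounds until all nodes have announced a result (`⊤` if this never happens). -/
def rounds (ω : Coins n) : ℕ∞ :=
  ⨅ t ∈ {t : ℕ | ∀ v, (A.outputAt G ω t v).isSome}, (t : ℕ∞)

/-- A link can deliver a distance: each real number in a message is the length of a walk of the
network with at most `M` edges. (With `M` polynomial in `n` and integer weights that are
polynomially bounded, these are numbers of `O(log n)` bits.) -/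
def SendsOnlyPathLengths (M : ℕ) : Prop :=
  ∀ (ω : Coins n) (t : ℕ) (v : Fin n) (msg : Message L) (x : ℝ),
    A.send (A.run G ω t v) = some msg → msg.value = some x →
      ∃ (a b : Fin n) (m : ℕ), m ≤ M ∧ G.HasWalk a b m x

/-- Whatever the coins, no node ever announces a wrong distance. -/
def AlwaysCorrect : Prop :=
  ∀ (ω : Coins n) (t : ℕ) (v : Fin n) (d : Fin n → EReal),
    A.outputAt G ω t v = some d → ∀ u, d u = G.dist u v

/-- Whatever the coins, all nodes announce their results in the same round (if ever), so that the
computation can stop there. -/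
def StopsSimultaneously : Prop :=
  ∀ (ω : Coins n) (t : ℕ) (v v' : Fin n),
    (A.outputAt G ω t v).isSome → (A.outputAt G ω t v').isSome

end NodeProgram

end

/-!
# All-pairs shortest paths in a near-linear number of rounds

The program repeats *attempts* of a fixed length `Õ(n)`. An attempt computes distances which are
correct with probability at least `1 - 1 / n`, and ends with a verification that is passed only if
they are correct. The expected number of attempts is then a geometric series, and `a` attempts in a
row fail with probability at most `n⁻ᵃ` (`coinMeasure_fails_le`, `lintegral_rounds_le`).

**Supersteps.** An attempt is a list of supersteps. In a superstep, a node broadcasts a set of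
numbers, each labelled by a pair of nodes, one number per round; if it has more than `cap` of them,
which is polylogarithmic, it sends nothing. So correctness needs no probability at all, and
congestion can only make an attempt fail. `Attempt.program` implements lists of supersteps.

**One attempt.** Let `N = 2 ^ L` with `L = ⌈log₂ n⌉`. Each node `v` chooses a random rank
`U v < N`. In level `i = 0, …, L`, all nodes `x` learn the distances `D s x` from the sources `s` of
rank less than `2 ^ i`, about `2 ^ i` in number.
* First, the recursion of Bellman and Ford is run with `h ≈ N / 2 ^ i · log n` steps, for the sources
  of rank `0`, of rank `1`, and so on, one rank after the other. With high probability, only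
  logarithmically many sources share a rank. Now every node `c` knows the `h`-hop distances `B s c`.
* A shortest path from `s` with more than `h` edges meets, with high probability, a node `c` of rank
  less than `2 ^ i / 2` (a *center*) in its first `h` vertices (`le_card_relays`). For such `c`,
  the node `x` knows `D c x` from the preceding level. So it remains to compute
  `min_c (B s c + D c x)` at every `x`.

**The filtered broadcast.** Each center `c` broadcasts a token with `B s c` for each source `s`, and
a node `x` forwards it only if `B s c + D c x` is less than the best value of `s` at `x` so far. No
value is lost, because a node that drops a token knows a value that is as good for all
nodes behind it (`reaches_or_through_le`). The centers act in phases: in phase `j`, those whose rank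
is less than `2 ^ j` but not less than `2 ^ j / 2`. Since a center of rank less than `2 ^ j` has
acted in an earlier phase with probability one half, the number of centers of phase `j` that
improve upon all earlier ones at `x`, for a given `s`, has a geometric tail (`prob_records_le`).
Hence each node forwards `O(n log n)` tokens in a phase. The tokens start with independent random
delays less than `N`, so that only polylogarithmically many of them are to be forwarded by the same
node in the same superstep (`prob_loadBad_le`).

**Verification.** Every node checks the inequalities `d s x ≤ d s y + w(y, x)` and `d x x ≤ 0` for
its estimates `d`, and a failure is flooded through the network. Since all estimates are lengths
of walks (`Sound`), a node that hears of no failure has the exact distances (`result_correct`). In a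
strongly connected network, all nodes hear of a failure, or none (`result_simultaneous`).
-/

noncomputable section

namespace APSP

open Classical

/-! ### Supersteps, and the node program that repeats attempts -/

/-- The names of the items that can be broadcast in a superstep: pairs of nodes. -/
abbrev Key (n : ℕ) : Type := Fin n × Fin n

/-- A superstep, in which a node may broadcast several real numbers, each under a key. Here `Λ` is
the type of the data of a node that stay fixed during an attempt (its input and its random choices),
and `S` is the type of its working memory. A value `⊤` stands for an absent item. -/
structure Step (n : ℕ) (Λ S : Type) where
  out : Λ → S → Key n → WithTop ℝ
  upd : Λ → S → (Fin n → Key n → WithTop ℝ) → S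

/-- The keys under which a value is present. -/
def keys {n : ℕ} (f : Key n → WithTop ℝ) : List (Key n) :=
  (Finset.univ.filter fun k => f k ≠ ⊤).toList

/-- A node that has more than `Q` items to broadcast in a superstep broadcasts nothing at all. -/
def capped {n : ℕ} (Q : ℕ) (f : Key n → WithTop ℝ) : Key n → WithTop ℝ :=
  if (keys f).length ≤ Q then f else fun _ => ⊤

section exec

variable {n : ℕ} {Λ S : Type} (G : Network n) (Q : ℕ) (loc : Fin n → Λ)

/-- The effect of a superstep on the memories of all nodes. -/
def Step.exec (p : Step n Λ S) (σ : Fin n → S) : Fin n → S := fun x =>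
  p.upd (loc x) (σ x) fun y =>
    if G.Adj y x then capped Q (p.out (loc y) (σ y)) else fun _ => ⊤

/-- The effect of a list of supersteps on the memories of all nodes. -/
def exec (l : List (Step n Λ S)) (σ : Fin n → S) : Fin n → S :=
  l.foldl (fun σ p => p.exec G Q loc σ) σ

@[simp] lemma exec_nil (σ : Fin n → S) : exec G Q loc [] σ = σ := rfl

@[simp] lemma exec_cons (p : Step n Λ S) (l : List (Step n Λ S)) (σ : Fin n → S) :
    exec G Q loc (p :: l) σ = exec G Q loc l (p.exec G Q loc σ) := rfl

@[simp] lemma exec_append (l l' : List (Step n Λ S)) (σ : Fin n → S) :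
    exec G Q loc (l ++ l') σ = exec G Q loc l' (exec G Q loc l σ) := List.foldl_append

/-- A property that is advanced by each block of a loop is advanced by the loop. -/
lemma exec_flatMap_range (f : ℕ → List (Step n Λ S)) (m : ℕ) (P : ℕ → (Fin n → S) → Prop)
    (h : ∀ i < m, ∀ σ, P i σ → P (i + 1) (exec G Q loc (f i) σ)) (σ : Fin n → S) (h0 : P 0 σ) :
    P m (exec G Q loc ((List.range m).flatMap f) σ) := by
  induction m with
  | zero => simpa using h0
  | succ m ih =>
    rw [List.range_succ, List.flatMap_append, exec_append]
    simpa using h m (by omega) _ (ih fun i hi => h i (by omega))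

end exec

lemma mem_keys {n : ℕ} {f : Key n → WithTop ℝ} {k : Key n} : k ∈ keys f ↔ f k ≠ ⊤ := by
  simp [keys]

lemma length_keys_capped {n : ℕ} (Q : ℕ) (f : Key n → WithTop ℝ) :
    (keys (capped Q f)).length ≤ Q := by
  unfold capped
  split_ifs with h
  · exact h
  · simp [keys]

lemma capped_eq_self {n Q : ℕ} {f : Key n → WithTop ℝ}
    (h : (Finset.univ.filter fun k => f k ≠ ⊤).card ≤ Q) : capped Q f = f := by
  unfold capped
  rw [if_pos]
  simpa [keys] using h

lemma capped_eq_or {n : ℕ} (Q : ℕ) (f : Key n → WithTop ℝ) (k : Key n) :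
    capped Q f k = f k ∨ capped Q f k = ⊤ := by
  unfold capped
  split_ifs <;> simp

/-- The part of a capped broadcast that has been transmitted after `o` rounds. -/
def transmitted {n : ℕ} (Q : ℕ) (f : Key n → WithTop ℝ) (o : ℕ) : Key n → WithTop ℝ :=
  fun k => if k ∈ (keys (capped Q f)).take o then capped Q f k else ⊤

lemma transmitted_zero {n : ℕ} (Q : ℕ) (f : Key n → WithTop ℝ) :
    transmitted Q f 0 = fun _ => ⊤ := by
  funext k; simp [transmitted]

lemma transmitted_all {n : ℕ} (Q : ℕ) (f : Key n → WithTop ℝ) :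
    transmitted Q f Q = capped Q f := by
  funext k
  unfold transmitted
  rw [List.take_of_length_le (length_keys_capped Q f)]
  by_cases h : capped Q f k = ⊤ <;> simp [mem_keys, h]

lemma transmitted_succ {n : ℕ} (Q : ℕ) (f : Key n → WithTop ℝ) (o : ℕ) (k : Key n) :
    transmitted Q f (o + 1) k =
      if (keys (capped Q f))[o]? = some k then capped Q f k else transmitted Q f o k := by
  unfold transmitted
  rw [List.take_add_one]
  by_cases h : (keys (capped Q f))[o]? = some k
  · simp [h]
  · have : k ∉ (keys (capped Q f))[o]?.toList := by
      simpa using h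
    simp [h, this]

/-- A randomized attempt to solve a problem: a list of supersteps that is run after every node has
tossed its coins. Each superstep lasts `cap` rounds. -/
structure Attempt (n L : ℕ) where
  Λ : Type
  S : Type
  numCoins : ℕ
  loc : LocalInput n → (Fin numCoins → Bool) → Λ
  start : S
  prog : List (Step n Λ S)
  result : Λ → S → Option (Fin n → EReal)
  cap : ℕ
  cap_pos : 0 < cap
  code : Key n → BitVec L
  code_injective : Function.Injective code

namespace Attempt

variable {n L : ℕ} (A : Attempt n L) (G : Network n)

/-- The memory of a node during an attempt: the working memory at the start of the current
superstep, the remaining supersteps, the number of rounds of the current one that have passed, and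
the items received in them. -/
structure Mode where
  loc : A.Λ
  mem : A.S
  rest : List (Step n A.Λ A.S)
  off : ℕ
  buf : Fin n → Key n → WithTop ℝ

/-- The state of a node. `mode` is `none` between two attempts. -/
structure NodeState where
  input : LocalInput n
  announced : Option (Fin n → EReal)
  mode : Option A.Mode

/-- The message sent in the current round: the next item of the current superstep. -/
def sendMsg (s : A.NodeState) : Option (Message L) :=
  match s.mode with
  | none => none
  | some m =>
    match m.rest with
    | [] => none
    | p :: _ => (keys (capped A.cap (p.out m.loc m.mem)))[m.off]?.map fun k =>
        ⟨A.code k, some ((capped A.cap (p.out m.loc m.mem) k).untopD 0)⟩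

/-- The change of state in a round. -/
def stepState (s : A.NodeState) (coins : Fin A.numCoins → Bool)
    (received : Fin n → Option (Message L)) : A.NodeState :=
  match s.mode with
  | none => ⟨s.input, s.announced,
      some ⟨A.loc s.input coins, A.start, A.prog, 0, fun _ _ => ⊤⟩⟩
  | some m =>
    match m.rest with
    | [] => ⟨s.input, s.announced.or (A.result m.loc m.mem), none⟩
    | p :: rest =>
      let buf : Fin n → Key n → WithTop ℝ := fun y k =>
        match received y with
        | none => m.buf y k
        | some msg => if msg.bits = A.code k then ((msg.value.getD 0 : ℝ) : WithTop ℝ)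
            else m.buf y k
      if m.off + 1 < A.cap then
        ⟨s.input, s.announced, some ⟨m.loc, m.mem, m.rest, m.off + 1, buf⟩⟩
      else
        ⟨s.input, s.announced, some ⟨m.loc, p.upd m.loc m.mem buf, rest, 0, fun _ _ => ⊤⟩⟩

/-- The program in which every node makes attempts for ever, and announces the result of the first
attempt in which it has one. -/
def program : NodeProgram n L where
  State := A.NodeState
  numCoins := A.numCoins
  init I := ⟨I, none, none⟩
  send := A.sendMsg
  step := A.stepState
  output s := s.announced
  output_final := by
    rintro ⟨I, a, m⟩ coins received d h
    simp only at h
    subst h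
    unfold stepState
    rcases m with _ | ⟨l, s, _ | ⟨p, rest⟩, o, b⟩
    · rfl
    · rfl
    · dsimp only
      split_ifs <;> rfl

/-- All nodes are between two attempts, having announced `ann`. -/
def idle (ann : Fin n → Option (Fin n → EReal)) : Fin n → A.NodeState :=
  fun x => ⟨G.localInput x, ann x, none⟩

/-- All nodes have the supersteps `rest` of an attempt before them, and are in round `o` of the
first one. -/
def busy (ann : Fin n → Option (Fin n → EReal)) (loc : Fin n → A.Λ) (σ : Fin n → A.S)
    (rest : List (Step n A.Λ A.S)) (o : ℕ) : Fin n → A.NodeState :=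
  fun x => ⟨G.localInput x, ann x, some ⟨loc x, σ x, rest, o, fun y =>
    if G.Adj y x then
      match rest with
      | [] => fun _ => ⊤
      | p :: _ => transmitted A.cap (p.out (loc y) (σ y)) o
    else fun _ => ⊤⟩⟩

lemma busy_zero (ann : Fin n → Option (Fin n → EReal)) (loc : Fin n → A.Λ) (σ : Fin n → A.S)
    (rest : List (Step n A.Λ A.S)) :
    A.busy G ann loc σ rest 0 =
      fun x => ⟨G.localInput x, ann x, some ⟨loc x, σ x, rest, 0, fun _ _ => ⊤⟩⟩ := by
  funext x
  unfold busy
  congr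
  funext y
  rcases rest with _ | ⟨p, rest⟩ <;> simp [transmitted_zero]

/-- The coins that are tossed in round `t`. -/
def coinsAt (ω : Coins n) (t : ℕ) : Fin n → Fin A.numCoins → Bool := fun v i => ω (t, v, i)

/-- The fixed data of all nodes in an attempt with the coins `ξ`. -/
def locs (ξ : Fin n → Fin A.numCoins → Bool) : Fin n → A.Λ := fun x => A.loc (G.localInput x) (ξ x)

/-- The result of the attempt with the coins `ξ`, at every node. -/
def outcome (ξ : Fin n → Fin A.numCoins → Bool) : Fin n → Option (Fin n → EReal) := fun x =>
  A.result (A.locs G ξ x) (exec G A.cap (A.locs G ξ) A.prog (fun _ => A.start) x)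

variable (ω : Coins n) (t : ℕ) {ann : Fin n → Option (Fin n → EReal)} {loc : Fin n → A.Λ}
  {σ : Fin n → A.S} {p : Step n A.Λ A.S} {rest : List (Step n A.Λ A.S)} {o : ℕ}

lemma run_succ_of_idle (h : A.program.run G ω t = A.idle G ann) :
    A.program.run G ω (t + 1) =
      A.busy G ann (A.locs G (A.coinsAt ω t)) (fun _ => A.start) A.prog 0 := by
  rw [busy_zero]
  funext x
  simp only [NodeProgram.run, h]
  rfl

lemma run_succ_of_busy_nil (h : A.program.run G ω t = A.busy G ann loc σ [] o) :
    A.program.run G ω (t + 1) = A.idle G (fun x => (ann x).or (A.result (loc x) (σ x))) := by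
  funext x
  simp only [NodeProgram.run, h]
  rfl

/-- The buffer of a node after one more round of a superstep. -/
lemma buffer_step (x y : Fin n) (k : Key n) :
    (match (if G.Adj y x then A.sendMsg (A.busy G ann loc σ (p :: rest) o y) else none) with
      | none => (if G.Adj y x then transmitted A.cap (p.out (loc y) (σ y)) o else fun _ => ⊤) k
      | some msg => if msg.bits = A.code k then ((msg.value.getD 0 : ℝ) : WithTop ℝ)
          else (if G.Adj y x then transmitted A.cap (p.out (loc y) (σ y)) o else fun _ => ⊤) k) =
      (if G.Adj y x then transmitted A.cap (p.out (loc y) (σ y)) (o + 1) else fun _ => ⊤) k := by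
  by_cases hy : G.Adj y x
  · simp only [if_pos hy, transmitted_succ]
    unfold sendMsg busy
    dsimp only
    rcases hk : (keys (capped A.cap (p.out (loc y) (σ y))))[o]? with _ | k'
    · simp
    · have hk' : capped A.cap (p.out (loc y) (σ y)) k' ≠ ⊤ := mem_keys.1 (List.mem_of_getElem? hk)
      by_cases hkk : k' = k
      · subst hkk
        obtain ⟨r, hr⟩ := WithTop.ne_top_iff_exists.1 hk'
        simp [← hr]
      · simp [hkk, A.code_injective.eq_iff]
  · simp [hy]

lemma run_succ_of_busy_lt (h : A.program.run G ω t = A.busy G ann loc σ (p :: rest) o)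
    (ho : o + 1 < A.cap) :
    A.program.run G ω (t + 1) = A.busy G ann loc σ (p :: rest) (o + 1) := by
  funext x
  simp only [NodeProgram.run, h]
  change A.stepState (A.busy G ann loc σ (p :: rest) o x) (fun i => ω (t, x, i)) (fun u =>
    if G.Adj u x then A.sendMsg (A.busy G ann loc σ (p :: rest) o u) else none) = _
  have := fun y k => A.buffer_step G (ann := ann) (loc := loc) (σ := σ) (p := p) (rest := rest)
    (o := o) x y k
  unfold stepState
  simp only [busy, ho, if_true] at this ⊢
  congr
  funext y k
  exact this y k

lemma run_succ_of_busy_last (h : A.program.run G ω t = A.busy G ann loc σ (p :: rest) o)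
    (ho : o + 1 = A.cap) :
    A.program.run G ω (t + 1) = A.busy G ann loc (p.exec G A.cap loc σ) rest 0 := by
  rw [busy_zero]
  funext x
  simp only [NodeProgram.run, h]
  change A.stepState (A.busy G ann loc σ (p :: rest) o x) (fun i => ω (t, x, i)) (fun u =>
    if G.Adj u x then A.sendMsg (A.busy G ann loc σ (p :: rest) o u) else none) = _
  have := fun y k => A.buffer_step G (ann := ann) (loc := loc) (σ := σ) (p := p) (rest := rest)
    (o := o) x y k
  simp only [ho, transmitted_all] at this
  unfold stepState Step.exec
  simp only [busy, ho, lt_irrefl, if_false] at this ⊢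
  congr
  funext y k
  exact this y k

lemma run_of_busy_superstep (h : A.program.run G ω t = A.busy G ann loc σ (p :: rest) 0) :
    A.program.run G ω (t + A.cap) = A.busy G ann loc (p.exec G A.cap loc σ) rest 0 := by
  have key : ∀ o < A.cap, A.program.run G ω (t + o) = A.busy G ann loc σ (p :: rest) o := by
    intro o
    induction o with
    | zero => intro _; exact h
    | succ o ih => intro ho; exact A.run_succ_of_busy_lt G ω (t + o) (ih (by omega)) ho
  obtain ⟨c, hc⟩ := Nat.exists_eq_succ_of_ne_zero A.cap_pos.ne'
  have := A.run_succ_of_busy_last G ω (t + c) (key c (by omega)) (by omega)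
  rwa [show t + A.cap = t + c + 1 by omega]

lemma run_of_busy_list (h : A.program.run G ω t = A.busy G ann loc σ rest 0) :
    A.program.run G ω (t + A.cap * rest.length) =
      A.busy G ann loc (exec G A.cap loc rest σ) [] 0 := by
  induction rest generalizing t σ with
  | nil => simpa using h
  | cons p rest ih =>
    have := ih (t + A.cap) (A.run_of_busy_superstep G ω t h)
    rw [exec_cons, ← this]
    congr 1
    simp only [List.length_cons]
    ring

/-- The number of rounds of an attempt: one round for the coins, the supersteps, and one round for
the announcement. -/
def period : ℕ := A.cap * A.prog.length + 2

lemma run_of_idle (h : A.program.run G ω t = A.idle G ann) :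
    A.program.run G ω (t + A.period) =
      A.idle G (fun x => (ann x).or (A.outcome G (A.coinsAt ω t) x)) := by
  have h1 := A.run_of_busy_list G ω (t + 1) (A.run_succ_of_idle G ω t h)
  have h2 := A.run_succ_of_busy_nil G ω _ h1
  rw [show t + A.period = t + 1 + A.cap * A.prog.length + 1 by unfold period; ring]
  exact h2

lemma exists_run_mul_period (a : ℕ) :
    ∃ ann, A.program.run G ω (a * A.period) = A.idle G ann := by
  induction a with
  | zero => exact ⟨fun _ => none, by rw [Nat.zero_mul]; rfl⟩
  | succ a ih =>
    obtain ⟨ann, h⟩ := ih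
    exact ⟨_, by rw [Nat.succ_mul]; exact A.run_of_idle G ω _ h⟩

/-- All nodes have announced a result by the end of the first attempt that succeeds everywhere. -/
lemma isSome_outputAt (a : ℕ)
    (h : ∀ x, (A.outcome G (A.coinsAt ω (a * A.period)) x).isSome) (x : Fin n) :
    (A.program.outputAt G ω ((a + 1) * A.period) x).isSome := by
  obtain ⟨ann, ha⟩ := A.exists_run_mul_period G ω a
  have := A.run_of_idle G ω _ ha
  rw [NodeProgram.outputAt, Nat.succ_mul, this]
  change ((ann x).or _).isSome
  simp [h x]

/-- In every round, the nodes are between two attempts, or in the same round of an attempt; and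
every property `R` of the announced results that is preserved by an attempt holds. -/
lemma run_cases (R : (Fin n → Option (Fin n → EReal)) → Prop) (h0 : R fun _ => none)
    (hR : ∀ ann ξ, R ann → R fun x => (ann x).or (A.outcome G ξ x)) :
    ∃ ann, R ann ∧ (A.program.run G ω t = A.idle G ann ∨
      ∃ ξ l₁ l₂ o, A.prog = l₁ ++ l₂ ∧ o < A.cap ∧ A.program.run G ω t =
        A.busy G ann (A.locs G ξ) (exec G A.cap (A.locs G ξ) l₁ fun _ => A.start) l₂ o) := by
  induction t with
  | zero => exact ⟨_, h0, Or.inl rfl⟩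
  | succ t ih =>
    obtain ⟨ann, hann, h | ⟨ξ, l₁, l₂, o, hl, ho, h⟩⟩ := ih
    · exact ⟨ann, hann, Or.inr ⟨_, [], A.prog, 0, rfl, A.cap_pos, A.run_succ_of_idle G ω t h⟩⟩
    · rcases l₂ with _ | ⟨p, l₂⟩
      · refine ⟨_, hR ann ξ hann, Or.inl ?_⟩
        rw [A.run_succ_of_busy_nil G ω t h]
        simp only [outcome, hl, List.append_nil]
        rfl
      · rcases Nat.lt_or_ge (o + 1) A.cap with ho' | ho'
        · exact ⟨ann, hann, Or.inr ⟨ξ, l₁, p :: l₂, o + 1, hl, ho',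
            A.run_succ_of_busy_lt G ω t h ho'⟩⟩
        · refine ⟨ann, hann, Or.inr ⟨ξ, l₁ ++ [p], l₂, 0, by simpa using hl, A.cap_pos, ?_⟩⟩
          rw [A.run_succ_of_busy_last G ω t h (by omega)]
          simp only [exec_append, exec_cons, exec_nil]
          rfl

lemma alwaysCorrect (h : ∀ ξ x d, A.outcome G ξ x = some d → ∀ u, d u = G.dist u x) :
    A.program.AlwaysCorrect G := by
  intro ω t v d hd
  obtain ⟨ann, hann, hc⟩ := A.run_cases G ω t
    (fun ann => ∀ x d, ann x = some d → ∀ u, d u = G.dist u x) (by simp) (by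
      intro ann ξ ha x d hd
      rcases Option.or_eq_some_iff.1 hd with h1 | ⟨-, h1⟩
      · exact ha x d h1
      · exact h ξ x d h1)
  refine hann v d ?_
  rw [NodeProgram.outputAt] at hd
  rcases hc with h | ⟨ξ, l₁, l₂, o, -, -, h⟩ <;> · rw [h] at hd; exact hd

lemma stopsSimultaneously
    (h : ∀ ξ x y, (A.outcome G ξ x).isSome → (A.outcome G ξ y).isSome) :
    A.program.StopsSimultaneously G := by
  intro ω t v v' hd
  obtain ⟨ann, hann, hc⟩ := A.run_cases G ω t
    (fun ann => ∀ x y, (ann x).isSome → (ann y).isSome) (by simp) (by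
      intro ann ξ ha x y hx
      rw [Option.isSome_or, Bool.or_eq_true] at hx ⊢
      exact hx.imp (ha x y) (h ξ x y))
  rw [NodeProgram.outputAt] at hd ⊢
  rcases hc with h | ⟨ξ, l₁, l₂, o, -, -, h⟩ <;>
  · rw [h] at hd ⊢
    exact hann v v' hd

lemma sendsOnlyPathLengths (M : ℕ)
    (h : ∀ ξ l₁ p l₂, A.prog = l₁ ++ p :: l₂ → ∀ x k (r : ℝ),
      p.out (A.locs G ξ x) (exec G A.cap (A.locs G ξ) l₁ (fun _ => A.start) x) k = (r : WithTop ℝ) →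
      ∃ (a b : Fin n) (m : ℕ), m ≤ M ∧ G.HasWalk a b m r) :
    A.program.SendsOnlyPathLengths G M := by
  intro ω t v msg r hs hv
  obtain ⟨ann, -, hc⟩ := A.run_cases G ω t (fun _ => True) trivial (fun _ _ _ => trivial)
  change A.sendMsg _ = _ at hs
  rcases hc with hc | ⟨ξ, l₁, l₂, o, hl, -, hc⟩
  · rw [hc] at hs
    simp [sendMsg, idle] at hs
  · rw [hc] at hs
    rcases l₂ with _ | ⟨p, l₂⟩
    · simp [sendMsg, busy] at hs
    · simp only [sendMsg, busy, Option.map_eq_some_iff] at hs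
      obtain ⟨k, hk, rfl⟩ := hs
      have hk' := mem_keys.1 (List.mem_of_getElem? hk)
      refine h ξ l₁ p l₂ hl v k r ?_
      obtain ⟨q, hq⟩ := WithTop.ne_top_iff_exists.1 hk'
      rcases capped_eq_or A.cap (p.out (A.locs G ξ v)
        (exec G A.cap (A.locs G ξ) l₁ (fun _ => A.start) v)) k with h1 | h1
      · rw [← h1, ← hq]
        simp only [← hq, WithTop.untopD_coe, Option.some.injEq] at hv
        rw [hv]
      · exact absurd h1 hk'

end Attempt

/-! ### Hop-bounded distances -/

section bf

/-- The extended reals are `WithBot (WithTop ℝ)`. -/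
def toEReal (v : WithTop ℝ) : EReal := WithBot.some v

variable {n : ℕ} (G : Network n)

/-- The weight of the edge from `y` to `x`; it is `⊤` if there is none. -/
def wt (y x : Fin n) : WithTop ℝ := if G.Adj y x then (G.weight y x : WithTop ℝ) else ⊤

/-- The minimum length of a walk from `s` to `x` with at most `h` edges, by the recursion of
Bellman and Ford. -/
def bf : ℕ → Fin n → Fin n → WithTop ℝ
  | 0 => fun s x => if s = x then 0 else ⊤
  | h + 1 => fun s x => min (bf h s x) (Finset.univ.inf fun y => bf h s y + wt G y x)

/-- The distance from `s` to `x`, as the minimum length of a walk with at most `n` edges. -/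
def D (s x : Fin n) : WithTop ℝ := bf G n s x

lemma bf_succ_le (h : ℕ) (s x : Fin n) : bf G (h + 1) s x ≤ bf G h s x := min_le_left _ _

lemma bf_succ_le_add (h : ℕ) (s y x : Fin n) : bf G (h + 1) s x ≤ bf G h s y + wt G y x :=
  (min_le_right _ _).trans (Finset.inf_le (Finset.mem_univ y))

lemma bf_anti {h h' : ℕ} (hh : h ≤ h') (s x : Fin n) : bf G h' s x ≤ bf G h s x :=
  antitone_nat_of_succ_le (f := fun h => bf G h s x) (fun h => bf_succ_le G h s x) hh

lemma bf_self (h : ℕ) (s : Fin n) : bf G h s s ≤ 0 :=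
  (bf_anti G (Nat.zero_le h) s s).trans (by simp [bf])

/-- An improvement in step `h + 1` comes over an edge. -/
lemma bf_succ_cases (h : ℕ) (s x : Fin n) :
    bf G (h + 1) s x = bf G h s x ∨ ∃ y, bf G (h + 1) s x = bf G h s y + wt G y x := by
  rcases min_choice (bf G h s x) (Finset.univ.inf fun y => bf G h s y + wt G y x) with h1 | h1
  · exact Or.inl h1
  · obtain ⟨y, -, hy⟩ := Finset.exists_mem_eq_inf Finset.univ ⟨x, Finset.mem_univ x⟩
      (fun y => bf G h s y + wt G y x)
    exact Or.inr ⟨y, h1.trans hy⟩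

variable {G}

lemma HasWalk.append {u v w : Fin n} {m m' : ℕ} {ℓ ℓ' : ℝ} (h : G.HasWalk u v m ℓ)
    (h' : G.HasWalk v w m' ℓ') : G.HasWalk u w (m + m') (ℓ + ℓ') := by
  induction h with
  | nil u => simpa using h'
  | @cons u x v m ℓ ha _ ih =>
    have := Network.HasWalk.cons ha (ih h')
    rw [show m + 1 + m' = m + m' + 1 by omega, add_assoc (G.weight u x)]
    exact this

/-- A finite value is the length of a walk from `s` to `x` with at most `M` edges. -/
def WalkBound (G : Network n) (M : ℕ) (s x : Fin n) (v : WithTop ℝ) : Prop :=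
  ∀ r : ℝ, v = r → ∃ m ≤ M, G.HasWalk s x m r

lemma WalkBound.top (M : ℕ) (s x : Fin n) : WalkBound G M s x ⊤ := by
  intro r h; simp at h

lemma WalkBound.zero (M : ℕ) (s : Fin n) : WalkBound G M s s 0 := by
  intro r h
  have : r = 0 := by exact_mod_cast h.symm
  exact ⟨0, Nat.zero_le _, this ▸ Network.HasWalk.nil s⟩

lemma WalkBound.mono {M M' : ℕ} {s x : Fin n} {v : WithTop ℝ} (hM : M ≤ M')
    (h : WalkBound G M s x v) : WalkBound G M' s x v := by
  intro r hr
  obtain ⟨m, hm, hw⟩ := h r hr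
  exact ⟨m, hm.trans hM, hw⟩

lemma WalkBound.min {M : ℕ} {s x : Fin n} {v w : WithTop ℝ} (hv : WalkBound G M s x v)
    (hw : WalkBound G M s x w) : WalkBound G M s x (min v w) := by
  rcases min_choice v w with h | h <;> rw [h] <;> assumption

lemma WalkBound.inf {ι : Type*} [Fintype ι] {M : ℕ} {s x : Fin n} {f : ι → WithTop ℝ}
    (hf : ∀ i, WalkBound G M s x (f i)) : WalkBound G M s x (Finset.univ.inf f) := by
  rcases Finset.univ.eq_empty_or_nonempty (α := ι) with h | h
  · rw [h, Finset.inf_empty]; exact WalkBound.top M s x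
  · obtain ⟨y, -, hy⟩ := Finset.exists_mem_eq_inf Finset.univ h f
    rw [hy]; exact hf y

lemma WalkBound.add {M M' : ℕ} {s y x : Fin n} {v w : WithTop ℝ} (hv : WalkBound G M s y v)
    (hw : WalkBound G M' y x w) : WalkBound G (M + M') s x (v + w) := by
  intro r hr
  obtain ⟨a, b, rfl, rfl, rfl⟩ := WithTop.add_eq_coe.1 hr
  obtain ⟨m, hm, h⟩ := hv a rfl
  obtain ⟨m', hm', h'⟩ := hw b rfl
  exact ⟨m + m', by omega, HasWalk.append h h'⟩

lemma WalkBound.wt (y x : Fin n) : WalkBound G 1 y x (wt G y x) := by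
  intro r hr
  unfold APSP.wt at hr
  split_ifs at hr with ha
  · have : G.weight y x = r := by exact_mod_cast hr
    have hw := Network.HasWalk.cons ha (Network.HasWalk.nil x)
    rw [add_zero, this] at hw
    exact ⟨1, le_rfl, hw⟩
  · simp at hr

lemma WalkBound.bf (h : ℕ) (s x : Fin n) : WalkBound G h s x (bf G h s x) := by
  induction h generalizing x with
  | zero =>
    unfold APSP.bf
    split_ifs with hs
    · subst hs; exact WalkBound.zero 0 s
    · exact WalkBound.top 0 s x
  | succ h ih =>
    exact ((ih x).mono (by omega)).min (WalkBound.inf fun y => (ih y).add (WalkBound.wt y x))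

lemma bf_add_le {h m : ℕ} {s y x : Fin n} {ℓ : ℝ} (hw : G.HasWalk y x m ℓ) :
    bf G (h + m) s x ≤ bf G h s y + ℓ := by
  induction hw generalizing h with
  | nil => simp
  | @cons u y v m ℓ ha _ ih =>
    have h1 := ih (h := h + 1)
    rw [show h + (m + 1) = h + 1 + m by omega]
    refine h1.trans ?_
    have h2 := bf_succ_le_add G h s u y
    rw [APSP.wt, if_pos ha] at h2
    push_cast
    rw [← add_assoc]
    gcongr

lemma bf_le {m : ℕ} {s x : Fin n} {ℓ : ℝ} (hw : G.HasWalk s x m ℓ) : bf G m s x ≤ ℓ := by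
  have := (bf_add_le (h := 0) (s := s) hw).trans (add_le_add_left (bf_self G 0 s) _)
  simpa using this

/-- The vertices of a walk, in order. -/
lemma HasWalk.exists_vertices {u v : Fin n} {m : ℕ} {ℓ : ℝ} (h : G.HasWalk u v m ℓ) :
    ∃ p : ℕ → Fin n, p 0 = u ∧ p m = v ∧ ∃ q : ℕ → ℝ, q 0 = 0 ∧ q m = ℓ ∧
      ∀ a b, a ≤ b → b ≤ m → G.HasWalk (p a) (p b) (b - a) (q b - q a) := by
  induction h with
  | nil u => exact ⟨fun _ => u, rfl, rfl, fun _ => 0, rfl, rfl, by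
      intro a b hab hb
      obtain rfl : b = 0 := by omega
      obtain rfl : a = 0 := by omega
      simpa using Network.HasWalk.nil u⟩
  | @cons u x v m ℓ ha hw ih =>
    obtain ⟨p, hp0, hpm, q, hq0, hqm, hpq⟩ := ih
    refine ⟨fun a => Nat.casesOn a u p, rfl, hpm,
      fun a => Nat.casesOn a 0 (fun a => G.weight u x + q a), rfl, by simp [hqm], ?_⟩
    intro a b hab hb
    rcases b with _ | b
    · obtain rfl : a = 0 := by omega
      simpa using Network.HasWalk.nil u
    · rcases a with _ | a
      · have := hpq 0 b (by omega) (by omega)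
        rw [hp0, hq0] at this
        simpa using Network.HasWalk.cons ha this
      · have := hpq a b (by omega) (by omega)
        simpa using this

/-- Cutting cycles out of a walk leaves a walk with fewer than `n` edges that is no longer. -/
lemma exists_short_walk (hG : G.NoNegativeCycle) {m : ℕ} {s x : Fin n} {ℓ : ℝ}
    (hw : G.HasWalk s x m ℓ) : ∃ m' < n, ∃ ℓ' ≤ ℓ, G.HasWalk s x m' ℓ' := by
  induction m using Nat.strong_induction_on generalizing ℓ with
  | _ m ih =>
    rcases Nat.lt_or_ge m n with hm | hm
    · exact ⟨m, hm, ℓ, le_rfl, hw⟩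
    · obtain ⟨p, hp0, hpm, q, hq0, hqm, hpq⟩ := HasWalk.exists_vertices hw
      -- Among the first `n + 1` vertices of the walk, one occurs twice.
      obtain ⟨a, b, hab, hpab⟩ := Fintype.exists_ne_map_eq_of_card_lt
        (fun a : Fin (n + 1) => p a) (by simp)
      wlog hlt : a < b generalizing a b
      · exact this b a hab.symm hpab.symm (lt_of_le_of_ne (not_lt.1 hlt) hab.symm)
      have hlt' : (a : ℕ) < b := hlt
      have hbn : (b : ℕ) ≤ m := by have := b.2; omega
      have h1 := hpq 0 a (by omega) (by omega)
      have h2 := hpq a b (by omega) hbn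
      have h3 := hpq b m hbn le_rfl
      rw [← hpab] at h2 h3
      have hc := hG _ _ _ h2
      have h4 := HasWalk.append h1 h3
      rw [hp0, hpm, hq0, hqm] at h4
      obtain ⟨m', hm', ℓ', hℓ', hw'⟩ := ih _ (by omega) h4
      exact ⟨m', hm', ℓ', by linarith, hw'⟩

variable (hG : G.NoNegativeCycle)
include hG

lemma D_le {m : ℕ} {s x : Fin n} {ℓ : ℝ} (hw : G.HasWalk s x m ℓ) : D G s x ≤ ℓ := by
  obtain ⟨m', hm', ℓ', hℓ', hw'⟩ := exists_short_walk hG hw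
  exact (bf_anti G hm'.le s x).trans ((bf_le hw').trans (by exact_mod_cast hℓ'))

lemma D_le_of_walkBound {M : ℕ} {s x : Fin n} {v : WithTop ℝ} (h : WalkBound G M s x v) :
    D G s x ≤ v := by
  induction v with
  | top => exact le_top
  | coe r => obtain ⟨m, -, hw⟩ := h r rfl; exact D_le hG hw

lemma D_le_bf (h : ℕ) (s x : Fin n) : D G s x ≤ bf G h s x :=
  D_le_of_walkBound hG (WalkBound.bf h s x)

lemma bf_eq_D {h : ℕ} (hh : n ≤ h) (s x : Fin n) : bf G h s x = D G s x :=
  le_antisymm (bf_anti G hh s x) (D_le_bf hG h s x)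

lemma D_self (s : Fin n) : D G s s = 0 := by
  refine le_antisymm (bf_self G n s) ?_
  by_contra h
  have hlt := not_le.1 h
  obtain ⟨r, hr⟩ := WithTop.ne_top_iff_exists.1 hlt.ne_top
  obtain ⟨m, -, hw⟩ := WalkBound.bf (G := G) n s s r hr.symm
  have := hG _ _ _ hw
  rw [← hr] at hlt
  have : r < 0 := by exact_mod_cast hlt
  linarith

lemma D_triangle (s y x : Fin n) : D G s x ≤ D G s y + D G y x :=
  D_le_of_walkBound hG ((WalkBound.bf n s y).add (WalkBound.bf n y x))

lemma D_le_add_wt (s y x : Fin n) : D G s x ≤ D G s y + wt G y x :=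
  D_le_of_walkBound hG ((WalkBound.bf n s y).add (WalkBound.wt y x))

lemma D_le_wt (y x : Fin n) : D G y x ≤ wt G y x :=
  D_le_of_walkBound hG (WalkBound.wt y x)

lemma D_ne_top {m : ℕ} {s x : Fin n} {ℓ : ℝ} (hw : G.HasWalk s x m ℓ) : D G s x ≠ ⊤ :=
  ne_top_of_le_ne_top (WithTop.coe_ne_top) (D_le hG hw)

omit hG in
lemma exists_bf_eq_D (s x : Fin n) : ∃ h, bf G h s x = D G s x := ⟨n, rfl⟩

/-- The nodes at which the `h`-hop distance from `s` is exact and which are on a shortest path from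
`s` to `v`. -/
def relays (G : Network n) (h : ℕ) (s v : Fin n) : Finset (Fin n) :=
  Finset.univ.filter fun c => bf G h s c + D G c v = D G s v

/-- If more than `h` edges are needed for a shortest path, then its first `h` vertices are distinct
nodes at which the `h`-hop distance is exact. They are told apart by the number of edges of a
shortest path to them. -/
lemma le_card_relays {h : ℕ} {s v : Fin n} (hv : bf G h s v ≠ D G s v) :
    h ≤ (relays G h s v).card := by
  let hop : Fin n → ℕ := fun c => Nat.find (exists_bf_eq_D (G := G) s c)
  have hop_spec : ∀ c, bf G (hop c) s c = D G s c := fun c => Nat.find_spec (exists_bf_eq_D (G := G) s c)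
  have hop_min : ∀ c m, bf G m s c = D G s c → hop c ≤ m :=
    fun c m hm => Nat.find_min' (exists_bf_eq_D (G := G) s c) hm
  have hDv : D G s v ≠ ⊤ := by
    intro htop
    have := D_le_bf hG h s v
    rw [htop, top_le_iff] at this
    exact hv (by rw [this, htop])
  have hle : h < hop v := by
    by_contra hlt
    exact hv (le_antisymm ((bf_anti G (not_lt.1 hlt) s v).trans (hop_spec v).le) (D_le_bf hG h s v))
  -- Walking back along a shortest path, the number of edges decreases by one at a time.
  have back : ∀ b ≤ hop v, ∃ c, hop c = hop v - b ∧ D G s c + D G c v = D G s v := by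
    intro b
    induction b with
    | zero => intro _; exact ⟨v, rfl, by rw [D_self hG, add_zero]⟩
    | succ b ih =>
      intro hb
      obtain ⟨c, hc, hDc⟩ := ih (by omega)
      obtain ⟨a, ha⟩ : ∃ a, hop c = a + 1 := ⟨hop v - b - 1, by omega⟩
      have h1 := hop_spec c
      rw [ha] at h1
      have hDc_top : D G s c ≠ ⊤ := by
        intro htop; rw [htop, top_add] at hDc; exact hDv hDc.symm
      rcases bf_succ_cases G a s c with h2 | ⟨y, h2⟩
      · have := hop_min c a (h2 ▸ h1); omega
      · have hsum : bf G a s y + wt G y c = D G s c := h2.symm.trans h1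
        have hne : bf G a s y + wt G y c ≠ ⊤ := hsum ▸ hDc_top
        have hwt : wt G y c ≠ ⊤ := (WithTop.add_ne_top.1 hne).2
        have hy : bf G a s y = D G s y := by
          refine le_antisymm ?_ (D_le_bf hG a s y)
          have := hsum.le.trans (D_le_add_wt hG s y c)
          exact (WithTop.add_le_add_iff_right hwt).1 this
        have hya : hop y = a := by
          refine le_antisymm (hop_min y a hy) ?_
          by_contra hlt
          have h3 : bf G (hop y + 1) s c ≤ D G s c := by
            refine (bf_succ_le_add G (hop y) s y c).trans ?_
            rw [hop_spec, ← hy, hsum]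
          have := hop_min c _ (le_antisymm h3 (D_le_bf hG _ s c))
          omega
        refine ⟨y, by omega, le_antisymm ?_ (D_triangle hG s y v)⟩
        calc D G s y + D G y v ≤ D G s y + (D G y c + D G c v) := by
              gcongr; exact D_triangle hG y c v
          _ ≤ D G s y + (wt G y c + D G c v) := by gcongr; exact D_le_wt hG y c
          _ = D G s v := by rw [← add_assoc, ← hy, hsum, hDc]
  have : Nonempty (Fin n) := ⟨v⟩
  choose! f hf using back
  have hinj : Set.InjOn (fun a => f (hop v - a)) (Finset.range h : Set ℕ) := by
    intro a ha b hb hab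
    simp only [Finset.coe_range, Set.mem_Iio] at ha hb
    have h1 := (hf (hop v - a) (by omega)).1
    have h2 := (hf (hop v - b) (by omega)).1
    simp only at hab
    rw [hab] at h1
    omega
  calc h = ((Finset.range h).image fun a => f (hop v - a)).card := by
        rw [Finset.card_image_of_injOn hinj, Finset.card_range]
    _ ≤ _ := by
        refine Finset.card_le_card fun c hc => ?_
        obtain ⟨a, ha, rfl⟩ := Finset.mem_image.1 hc
        rw [Finset.mem_range] at ha
        have h1 := hf (hop v - a) (by omega)
        have h2 : bf G h s (f (hop v - a)) = D G s (f (hop v - a)) :=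
          le_antisymm ((bf_anti G (by omega) s _).trans (hop_spec _).le) (D_le_bf hG h s _)
        simp only [relays, Finset.mem_filter, Finset.mem_univ, true_and]
        rw [h2]; exact h1.2

lemma dist_eq_D (s x : Fin n) : toEReal (D G s x) = G.dist s x := by
  unfold Network.dist
  apply le_antisymm
  · refine le_sInf ?_
    rintro _ ⟨m, ℓ, hw, rfl⟩
    exact WithBot.coe_le_coe.2 (D_le hG hw)
  · rcases eq_or_ne (D G s x) ⊤ with h | h
    · rw [h]; exact le_top
    · obtain ⟨r, hr⟩ := WithTop.ne_top_iff_exists.1 h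
      obtain ⟨m, -, hw⟩ := WalkBound.bf (G := G) n s x r hr.symm
      rw [← hr]
      exact sInf_le ⟨m, r, hw, rfl⟩

end bf

/-! ### The supersteps of an attempt -/

section Algorithm

/-- The fixed data of a node during an attempt: its input, its rank, and the delay with which it
starts the token for each source. -/
structure Loc (n : ℕ) where
  inp : LocalInput n
  rank : ℕ
  delay : Fin n → ℕ

/-- The working memory of a node `x`.
* `d s` is the estimate of the distance from `s` that the preceding level has left;
* `cur s` is the estimate in the current run of the Bellman-Ford recursion;
* `B s` is the result of these runs in the current level;
* `T s` is the best estimate in the current level of a distance from `s` through a center;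
* `tokV (s, c)` is the value of the token for the source `s` and the center `c` (`⊤` if `x` has not
  received it), and `tokT (s, c)` is the time at which `x` is to forward it;
* `bad` says that the verification has failed. -/
structure Mem (n : ℕ) where
  d : Fin n → WithTop ℝ
  B : Fin n → WithTop ℝ
  cur : Fin n → WithTop ℝ
  T : Fin n → WithTop ℝ
  tokV : Key n → WithTop ℝ
  tokT : Key n → ℕ
  bad : Prop

/-- The memory at the start of an attempt. -/
def Mem.start (n : ℕ) : Mem n :=
  ⟨fun _ => ⊤, fun _ => ⊤, fun _ => ⊤, fun _ => ⊤, fun _ => ⊤, fun _ => 0, False⟩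

variable {n : ℕ}

/-- The weight of the incoming edge from `y`; it is `⊤` if there is none. -/
def Loc.wt (a : Loc n) (y : Fin n) : WithTop ℝ := ((a.inp.inEdge y).map WithTop.some).getD ⊤

/-- A superstep without messages. -/
def silent (f : Loc n → Mem n → Mem n) : Step n (Loc n) (Mem n) where
  out _ _ _ := ⊤
  upd a m _ := f a m

/-- Clear the results of the preceding level. -/
def levelInit : Step n (Loc n) (Mem n) := silent fun _ m => { m with B := fun _ => ⊤, T := fun _ => ⊤ }

/-- The sources of slot `u` are the nodes of rank `u`. -/
def slotInit (u : ℕ) : Step n (Loc n) (Mem n) :=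
  silent fun a m => { m with cur := fun s => if s = a.inp.id ∧ a.rank = u then 0 else ⊤ }

/-- A step of the Bellman-Ford recursion for all sources of a slot. -/
def bfStep : Step n (Loc n) (Mem n) where
  out _ m k := if k.1 = k.2 then m.cur k.1 else ⊤
  upd a m r := { m with
    cur := fun s => min (m.cur s) (Finset.univ.inf fun y => r y (s, s) + a.wt y) }

/-- Record the results of a slot. -/
def slotEnd : Step n (Loc n) (Mem n) :=
  silent fun _ m => { m with B := fun s => min (m.B s) (m.cur s) }

/-- The centers of phase `j` are the nodes of rank at least `2 ^ j / 2` and less than `2 ^ j`. Each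
of them creates a token for every source from which it has an estimate. -/
def tokInit (j : ℕ) : Step n (Loc n) (Mem n) :=
  silent fun a m => { m with
    tokV := fun k => if k.2 = a.inp.id ∧ 2 ^ j / 2 ≤ a.rank ∧ a.rank < 2 ^ j then m.B k.1 else ⊤
    tokT := fun k => if k.2 = a.inp.id then a.delay k.1 else 0 }

/-- A node forwards the tokens that are due at time `t` and improve upon its estimate at the start
of the phase. -/
def tokStep (t : ℕ) : Step n (Loc n) (Mem n) where
  out _ m k := if m.tokT k = t ∧ m.tokV k + m.d k.2 < m.T k.1 then m.tokV k else ⊤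
  upd _ m r := { m with
    tokV := fun k => if m.tokV k = ⊤ then Finset.univ.inf fun y => r y k else m.tokV k
    tokT := fun k => if m.tokV k = ⊤ then t + 1 else m.tokT k }

/-- Use the tokens that have been received. -/
def tokEnd : Step n (Loc n) (Mem n) :=
  silent fun _ m => { m with
    T := fun s => min (m.T s) (Finset.univ.inf fun c => m.tokV (s, c) + m.d c) }

/-- Record the results of a level. -/
def levelEnd : Step n (Loc n) (Mem n) :=
  silent fun _ m => { m with d := fun s => min (m.B s) (m.T s) }

/-- A node checks its distance from itself. -/
def verInit : Step n (Loc n) (Mem n) :=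
  silent fun a m => { m with bad := ¬ m.d a.inp.id ≤ 0 }

/-- A node checks the edges into it, for the distances from `s`. -/
def verStep (s : Fin n) : Step n (Loc n) (Mem n) where
  out _ m k := if k = (s, s) then m.d s else ⊤
  upd a m r := { m with bad := m.bad ∨ ∃ y, r y (s, s) + a.wt y < m.d s }

/-- A node that knows of a failed check tells its out-neighbours. The number that is sent is the
length of a walk without edges. -/
def floodStep : Step n (Loc n) (Mem n) where
  out a m k := if m.bad ∧ k = (a.inp.id, a.inp.id) then 0 else ⊤
  upd _ m r := { m with bad := m.bad ∨ ∃ y k, r y k ≠ ⊤ }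

/-- The part of a level that computes the `h`-hop distances from the nodes of rank `u`. -/
def slot (h u : ℕ) : List (Step n (Loc n) (Mem n)) :=
  slotInit u :: (List.replicate h bfStep ++ [slotEnd])

/-- The part of a level that distributes the tokens of phase `j`. -/
def phase (τ j : ℕ) : List (Step n (Loc n) (Mem n)) :=
  tokInit j :: ((List.range τ).map tokStep ++ [tokEnd])

/-- Level `i`: it computes the distances from all nodes of rank less than `2 ^ i`. -/
def level (h τ i : ℕ) : List (Step n (Loc n) (Mem n)) :=
  levelInit :: ((List.range (2 ^ i)).flatMap (slot h) ++
    ((List.range i).flatMap (phase τ) ++ [levelEnd]))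

/-- The verification of the distances. -/
def verify (n : ℕ) : List (Step n (Loc n) (Mem n)) :=
  verInit :: ((List.finRange n).map verStep ++ List.replicate n floodStep)

/-- All levels up to `L`, and the verification. -/
def fullProgram (n L τ : ℕ) (h : ℕ → ℕ) : List (Step n (Loc n) (Mem n)) :=
  (List.range (L + 1)).flatMap (fun i => level (h i) τ i) ++ verify n

/-- The result of a node: its distances, unless the verification has failed. -/
def resultOf (m : Mem n) : Option (Fin n → EReal) :=
  if m.bad then none else some fun s => toEReal (m.d s)

end Algorithm

/-! ### All numbers are lengths of walks -/

section Sound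

variable {n : ℕ} (G : Network n) (Q : ℕ) (loc : Fin n → Loc n)

/-- The fixed data of the nodes fit the network. -/
def Fits : Prop := ∀ x, (loc x).inp = G.localInput x

variable {G loc} in
lemma Fits.id (h : Fits G loc) (x : Fin n) : (loc x).inp.id = x := by rw [h x]; rfl

variable {G loc} in
lemma Fits.wt (h : Fits G loc) (y x : Fin n) : (loc x).wt y = APSP.wt G y x := by
  unfold Loc.wt APSP.wt
  rw [h x]
  simp only [Network.localInput]
  split_ifs <;> rfl

/-- All values that are broadcast while a list of supersteps is executed are lengths of walks with
at most `M` edges. -/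
def Safe (M : ℕ) : List (Step n (Loc n) (Mem n)) → (Fin n → Mem n) → Prop
  | [], _ => True
  | p :: l, σ => (∀ x k, ∃ a b, WalkBound G M a b (p.out (loc x) (σ x) k)) ∧
      Safe M l (p.exec G Q loc σ)

/-- Started from a configuration with the property `P`, the supersteps broadcast lengths of walks
with at most `M` edges only, and end in a configuration with the property `P'`. -/
def Triple (M : ℕ) (P : (Fin n → Mem n) → Prop) (l : List (Step n (Loc n) (Mem n)))
    (P' : (Fin n → Mem n) → Prop) : Prop :=
  ∀ σ, P σ → Safe G Q loc M l σ ∧ P' (exec G Q loc l σ)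

variable {G Q loc} {M : ℕ} {P P' P'' : (Fin n → Mem n) → Prop}
  {p : Step n (Loc n) (Mem n)} {l l' : List (Step n (Loc n) (Mem n))}

lemma Safe.out {l₁ l₂ : List (Step n (Loc n) (Mem n))} {σ : Fin n → Mem n}
    (h : Safe G Q loc M (l₁ ++ p :: l₂) σ) (x : Fin n) (k : Key n) :
    ∃ a b, WalkBound G M a b (p.out (loc x) (exec G Q loc l₁ σ x) k) := by
  induction l₁ generalizing σ with
  | nil => exact h.1 x k
  | cons q l₁ ih => exact ih h.2

lemma Triple.nil (h : ∀ σ, P σ → P' σ) : Triple G Q loc M P [] P' := fun σ hσ => ⟨trivial, h σ hσ⟩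

lemma Triple.append (h : Triple G Q loc M P l P') (h' : Triple G Q loc M P' l' P'') :
    Triple G Q loc M P (l ++ l') P'' := by
  induction l generalizing P with
  | nil => exact fun σ hσ => h' σ (h σ hσ).2
  | cons p l ih =>
    intro σ hσ
    have := ih (P := fun σ' => σ' = p.exec G Q loc σ)
      (by rintro _ rfl; exact ⟨(h σ hσ).1.2, (h σ hσ).2⟩) _ rfl
    exact ⟨⟨(h σ hσ).1.1, this.1⟩, this.2⟩

lemma Triple.cons (h : Triple G Q loc M P [p] P') (h' : Triple G Q loc M P' l P'') :
    Triple G Q loc M P (p :: l) P'' := h.append h'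

lemma Triple.flatMap_range {f : ℕ → List (Step n (Loc n) (Mem n))} {m : ℕ}
    {I : ℕ → (Fin n → Mem n) → Prop} (h : ∀ i < m, Triple G Q loc M (I i) (f i) (I (i + 1))) :
    Triple G Q loc M (I 0) ((List.range m).flatMap f) (I m) := by
  induction m with
  | zero => exact Triple.nil fun _ h => h
  | succ m ih =>
    rw [List.range_succ, List.flatMap_append]
    exact (ih fun i hi => h i (by omega)).append (by simpa using h m (by omega))

lemma Triple.list {α : Type*} {f : α → Step n (Loc n) (Mem n)} (l : List α)
    (h : ∀ a ∈ l, Triple G Q loc M P [f a] P) : Triple G Q loc M P (l.map f) P := by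
  induction l with
  | nil => exact Triple.nil fun _ h => h
  | cons a l ih =>
    exact (h a (by simp)).cons (ih fun b hb => h b (by simp [hb]))

lemma Triple.silent {f : Loc n → Mem n → Mem n}
    (h : ∀ σ, P σ → P' fun x => f (loc x) (σ x)) :
    Triple G Q loc M P [silent f] P' :=
  fun σ hσ => ⟨⟨fun x _ => ⟨x, x, WalkBound.top _ _ _⟩, trivial⟩, h σ hσ⟩

variable (G Q loc) in
/-- What a node `x` can receive from `y` in a superstep. -/
def received (p : Step n (Loc n) (Mem n)) (σ : Fin n → Mem n) (x y : Fin n) (k : Key n) :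
    WithTop ℝ :=
  (if G.Adj y x then capped Q (p.out (loc y) (σ y)) else fun _ => ⊤) k

lemma Step.exec_eq (σ : Fin n → Mem n) :
    p.exec G Q loc σ = fun x => p.upd (loc x) (σ x) (received G Q loc p σ x) := rfl

lemma received_eq_or (σ : Fin n → Mem n) (x y : Fin n) (k : Key n) :
    (G.Adj y x ∧ received G Q loc p σ x y k = p.out (loc y) (σ y) k) ∨
      received G Q loc p σ x y k = ⊤ := by
  unfold received
  split_ifs with h
  · rcases capped_eq_or Q (p.out (loc y) (σ y)) k with h1 | h1
    · exact Or.inl ⟨h, h1⟩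
    · exact Or.inr h1
  · exact Or.inr rfl

lemma received_walkBound {σ : Fin n → Mem n} {x y a b : Fin n} {k : Key n}
    (h : WalkBound G M a b (p.out (loc y) (σ y) k)) :
    WalkBound G M a b (received G Q loc p σ x y k) := by
  rcases received_eq_or (p := p) (Q := Q) (G := G) (loc := loc) σ x y k with h1 | h1
  · rw [h1.2]; exact h
  · rw [h1]; exact WalkBound.top _ _ _

/-- The estimates in level `i` are lengths of walks. The parameter `H` bounds the number of edges in
a run of the Bellman-Ford recursion, and `e` is the bound for the present state of the run. -/
structure Sound (G : Network n) (H i e : ℕ) (σ : Fin n → Mem n) : Prop where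
  d : ∀ x s, WalkBound G (i * H) s x ((σ x).d s)
  B : ∀ x s, WalkBound G H s x ((σ x).B s)
  cur : ∀ x s, WalkBound G e s x ((σ x).cur s)
  T : ∀ x s, WalkBound G ((i + 1) * H) s x ((σ x).T s)
  tok : ∀ x k, WalkBound G H k.1 k.2 ((σ x).tokV k)

variable {H : ℕ}

lemma Sound.start (H : ℕ) : Sound G H 0 H fun _ => Mem.start n :=
  ⟨fun _ _ => .top _ _ _, fun _ _ => .top _ _ _, fun _ _ => .top _ _ _, fun _ _ => .top _ _ _,
    fun _ _ => .top _ _ _⟩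

variable (hf : Fits G loc)
include hf

lemma triple_slot {h u i : ℕ} (hh : h ≤ H) (hM : H ≤ M) :
    Triple G Q loc M (Sound G H i H) (slot h u) (Sound G H i H) := by
  refine Triple.cons (P' := Sound G H i 0) (Triple.silent fun σ hσ => ?_) (Triple.append
    (P' := Sound G H i h) ?_ (Triple.silent fun σ hσ => ?_))
  · refine ⟨hσ.d, hσ.B, fun x s => ?_, hσ.T, hσ.tok⟩
    dsimp only
    split_ifs with hs
    · rw [hs.1, hf.id]; exact .zero _ _
    · exact .top _ _ _
  · have : ∀ m ≤ h, Triple G Q loc M (Sound G H i 0) (List.replicate m bfStep)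
        (Sound G H i m) := by
      intro m
      induction m with
      | zero => exact fun _ => Triple.nil fun _ h => h
      | succ m ih =>
        intro hm
        rw [List.replicate_succ']
        refine (ih (by omega)).append fun σ hσ => ⟨⟨fun x k => ?_, trivial⟩, ?_⟩
        · refine ⟨k.1, x, ?_⟩
          unfold bfStep
          dsimp only
          split_ifs
          · exact (hσ.cur x k.1).mono (by omega)
          · exact .top _ _ _
        · refine ⟨hσ.d, hσ.B, fun x s => ((hσ.cur x s).mono (by omega)).min
            (WalkBound.inf fun y => WalkBound.add (y := y) ?_ ?_), hσ.T, hσ.tok⟩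
          · refine received_walkBound ?_
            unfold bfStep
            simpa using hσ.cur y s
          · rw [hf.wt]; exact .wt y x
    exact this h le_rfl
  · exact ⟨hσ.d, fun x s => (hσ.B x s).min ((hσ.cur x s).mono hh),
      fun x s => (hσ.cur x s).mono hh, hσ.T, hσ.tok⟩

lemma triple_phase {τ j i : ℕ} (hM : H ≤ M) :
    Triple G Q loc M (Sound G H i H) (phase τ j) (Sound G H i H) := by
  refine Triple.cons (P' := Sound G H i H) (Triple.silent fun σ hσ => ?_) (Triple.append
    (P' := Sound G H i H) (Triple.list _ fun t _ σ hσ => ⟨⟨fun x k => ?_, trivial⟩, ?_⟩)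
    (Triple.silent fun σ hσ => ?_))
  · refine ⟨hσ.d, hσ.B, hσ.cur, hσ.T, fun x k => ?_⟩
    dsimp only
    split_ifs with hk
    · rw [hk.1, hf.id]; exact hσ.B x k.1
    · exact .top _ _ _
  · refine ⟨k.1, k.2, ?_⟩
    unfold tokStep
    dsimp only
    split_ifs
    · exact (hσ.tok x k).mono hM
    · exact .top _ _ _
  · refine ⟨hσ.d, hσ.B, hσ.cur, hσ.T, fun x k => ?_⟩
    change WalkBound G H k.1 k.2 (if _ then _ else _)
    split_ifs
    · refine WalkBound.inf fun y => received_walkBound ?_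
      unfold tokStep
      dsimp only
      split_ifs
      · exact hσ.tok y k
      · exact .top _ _ _
    · exact hσ.tok x k
  · refine ⟨hσ.d, hσ.B, hσ.cur, fun x s => (hσ.T x s).min (WalkBound.inf fun c => ?_), hσ.tok⟩
    exact ((hσ.tok x (s, c)).add (hσ.d x c)).mono (by rw [add_mul, one_mul, add_comm])

lemma triple_level {h τ i : ℕ} (hh : h ≤ H) (hM : H ≤ M) :
    Triple G Q loc M (Sound G H i H) (level h τ i) (Sound G H (i + 1) H) := by
  refine Triple.cons (P' := Sound G H i H) (Triple.silent fun σ hσ => ?_) (Triple.append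
    (Triple.flatMap_range (I := fun _ => Sound G H i H) fun u _ => triple_slot hf hh hM)
    (Triple.append (Triple.flatMap_range (I := fun _ => Sound G H i H) fun j _ =>
      triple_phase hf hM) (Triple.silent fun σ hσ => ?_)))
  · exact ⟨hσ.d, fun x s => .top _ _ _, hσ.cur, fun x s => .top _ _ _, hσ.tok⟩
  · refine ⟨fun x s => WalkBound.min ?_ (hσ.T x s), hσ.B, hσ.cur,
      fun x s => (hσ.T x s).mono (by gcongr; omega), hσ.tok⟩
    exact (hσ.B x s).mono (by rw [add_mul, one_mul]; omega)

omit hf in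
lemma triple_verify {i : ℕ} (hM : i * H ≤ M) :
    Triple G Q loc M (Sound G H i H) (verify n) (Sound G H i H) := by
  refine Triple.cons (P' := Sound G H i H) (Triple.silent fun σ hσ => ?_) (Triple.append
    (P' := Sound G H i H) (Triple.list _ fun s _ σ hσ => ⟨⟨fun x k => ?_, trivial⟩, ?_⟩) ?_)
  · exact ⟨hσ.d, hσ.B, hσ.cur, hσ.T, hσ.tok⟩
  · refine ⟨s, x, ?_⟩
    unfold verStep
    dsimp only
    split_ifs
    · exact (hσ.d x s).mono hM
    · exact .top _ _ _
  · exact ⟨hσ.d, hσ.B, hσ.cur, hσ.T, hσ.tok⟩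
  · rw [show List.replicate n floodStep = (List.range n).map fun _ => floodStep by simp]
    refine Triple.list (f := fun _ => floodStep) _ fun s _ σ hσ => ⟨⟨fun x k => ?_, trivial⟩, ?_⟩
    · refine ⟨x, x, ?_⟩
      unfold floodStep
      dsimp only
      split_ifs
      · exact .zero _ _
      · exact .top _ _ _
    · exact ⟨hσ.d, hσ.B, hσ.cur, hσ.T, hσ.tok⟩

lemma triple_levels {L τ : ℕ} {h : ℕ → ℕ} (hh : ∀ i, h i ≤ H) (hM : H ≤ M) :
    Triple G Q loc M (Sound G H 0 H) ((List.range (L + 1)).flatMap fun i => level (h i) τ i)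
      (Sound G H (L + 1) H) :=
  Triple.flatMap_range (I := fun i => Sound G H i H) fun i _ => triple_level hf (hh i) hM

lemma triple_fullProgram {L τ : ℕ} {h : ℕ → ℕ} (hh : ∀ i, h i ≤ H) (hM : (L + 1) * H ≤ M) :
    Triple G Q loc M (Sound G H 0 H) (fullProgram n L τ h) (Sound G H (L + 1) H) :=
  (triple_levels hf hh (le_trans (by nlinarith [Nat.zero_le (L * H)]) hM)).append
    (triple_verify hM)

end Sound

/-! ### The verification -/

section Verification

variable {n : ℕ} {G : Network n} {Q : ℕ} {loc : Fin n → Loc n}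

lemma received_eq {p : Step n (Loc n) (Mem n)} {σ : Fin n → Mem n} {x y : Fin n}
    (h : G.Adj y x → (Finset.univ.filter fun k => p.out (loc y) (σ y) k ≠ ⊤).card ≤ Q) (k : Key n) :
    received G Q loc p σ x y k = if G.Adj y x then p.out (loc y) (σ y) k else ⊤ := by
  unfold received
  split_ifs with ha
  · rw [capped_eq_self (h ha)]
  · rfl

lemma exec_silent (f : Loc n → Mem n → Mem n) (σ : Fin n → Mem n) :
    (silent f).exec G Q loc σ = fun x => f (loc x) (σ x) := rfl

lemma wt_eq_top {y x : Fin n} (h : ¬ G.Adj y x) : wt G y x = ⊤ := if_neg h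

variable (hf : Fits G loc) (hQ : 1 ≤ Q)
include hf hQ

lemma exec_verStep (s : Fin n) (σ : Fin n → Mem n) :
    (verStep s).exec G Q loc σ = fun x => { σ x with
      bad := (σ x).bad ∨ ∃ y, (σ y).d s + wt G y x < (σ x).d s } := by
  funext x
  rw [Step.exec_eq]
  have h : ∀ y, received G Q loc (verStep s) σ x y (s, s) + (loc x).wt y =
      (σ y).d s + wt G y x := by
    intro y
    rw [received_eq, hf.wt]
    · by_cases ha : G.Adj y x
      · simp [ha, verStep]
      · simp [wt_eq_top ha]
    · intro _
      refine (Finset.card_le_card (t := {(s, s)}) fun k hk => ?_).trans (by simpa using hQ)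
      simp only [verStep, Finset.mem_filter, ne_eq, ite_eq_right_iff, not_forall] at hk
      simpa using hk.2.1
  simp only [verStep] at h ⊢
  simp only [h]

lemma exec_verSteps (l : List (Fin n)) (σ : Fin n → Mem n) :
    exec G Q loc (l.map verStep) σ = fun x => { σ x with
      bad := (σ x).bad ∨ ∃ s ∈ l, ∃ y, (σ y).d s + wt G y x < (σ x).d s } := by
  induction l generalizing σ with
  | nil => simp
  | cons s l ih =>
    rw [List.map_cons, exec_cons, exec_verStep hf hQ, ih]
    funext x
    simp only [List.mem_cons, exists_eq_or_imp, or_assoc]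

lemma exec_floodStep (σ : Fin n → Mem n) :
    floodStep.exec G Q loc σ = fun x => { σ x with
      bad := (σ x).bad ∨ ∃ y, G.Adj y x ∧ (σ y).bad } := by
  funext x
  rw [Step.exec_eq]
  have h : ∀ y k, received G Q loc floodStep σ x y k =
      if G.Adj y x then (if (σ y).bad ∧ k = (y, y) then 0 else ⊤) else ⊤ := by
    intro y k
    rw [received_eq]
    · simp only [floodStep, hf.id]
    · intro _
      refine (Finset.card_le_card (t := {(y, y)}) fun k hk => ?_).trans (by simpa using hQ)
      simp only [floodStep, hf.id, Finset.mem_filter, ne_eq, ite_eq_right_iff, not_forall] at hk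
      simpa using hk.2.1.2
  change ({ σ x with bad := (σ x).bad ∨ ∃ y k, received G Q loc floodStep σ x y k ≠ ⊤ } : Mem n) = _
  simp only [h, ne_eq, ite_eq_right_iff, WithTop.zero_ne_top, imp_false, not_forall, not_not]
  congr 2
  refine propext (exists_congr fun y => ⟨?_, ?_⟩)
  · rintro ⟨k, ha, hb, -⟩; exact ⟨ha, hb⟩
  · rintro ⟨ha, hb⟩; exact ⟨(y, y), ha, hb, rfl⟩

omit hf hQ in
lemma bf_succ_ne_top (m : ℕ) (y x : Fin n) :
    bf G (m + 1) y x ≠ ⊤ ↔ bf G m y x ≠ ⊤ ∨ ∃ z, bf G m y z ≠ ⊤ ∧ G.Adj z x := by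
  constructor
  · intro h
    rcases bf_succ_cases G m y x with h1 | ⟨z, h1⟩
    · exact Or.inl (h1 ▸ h)
    · rw [h1, WithTop.add_ne_top] at h
      refine Or.inr ⟨z, h.1, ?_⟩
      by_contra ha
      exact h.2 (wt_eq_top ha)
  · rintro (h | ⟨z, h, ha⟩)
    · exact ne_top_of_le_ne_top h (bf_succ_le G m y x)
    · refine ne_top_of_le_ne_top (WithTop.add_ne_top.2 ⟨h, ?_⟩) (bf_succ_le_add G m y z x)
      rw [APSP.wt, if_pos ha]
      exact WithTop.coe_ne_top

lemma exec_floodSteps (m : ℕ) (σ : Fin n → Mem n) :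
    exec G Q loc (List.replicate m floodStep) σ = fun x => { σ x with
      bad := ∃ y, (σ y).bad ∧ bf G m y x ≠ ⊤ } := by
  induction m with
  | zero => simp [bf]
  | succ m ih =>
    rw [List.replicate_succ', exec_append, ih, exec_cons, exec_nil, exec_floodStep hf hQ]
    funext x
    simp only [bf_succ_ne_top]
    congr 1
    refine propext ⟨?_, ?_⟩
    · rintro (⟨y, hy, h⟩ | ⟨z, ha, y, hy, h⟩)
      · exact ⟨y, hy, Or.inl h⟩
      · exact ⟨y, hy, Or.inr ⟨z, h, ha⟩⟩
    · rintro ⟨y, hy, h | ⟨z, h, ha⟩⟩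
      · exact Or.inl ⟨y, hy, h⟩
      · exact Or.inr ⟨z, ha, y, hy, h⟩

omit hf hQ in
variable (G) in
/-- One of the checks at `x` fails. -/
def Fails (σ : Fin n → Mem n) (x : Fin n) : Prop :=
  ¬ (σ x).d x ≤ 0 ∨ ∃ s y, (σ y).d s + wt G y x < (σ x).d s

lemma exec_verify (σ : Fin n → Mem n) :
    exec G Q loc (verify n) σ = fun x => { σ x with
      bad := ∃ y, Fails G σ y ∧ D G y x ≠ ⊤ } := by
  rw [verify, exec_cons, exec_append, exec_verSteps hf hQ, exec_floodSteps hf hQ, verInit,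
    exec_silent]
  simp only [hf.id, List.mem_finRange, true_and]
  rfl

lemma result_correct (hG : G.NoNegativeCycle) {H i e : ℕ} {σ : Fin n → Mem n}
    (hσ : Sound G H i e σ) {x : Fin n} {δ : Fin n → EReal}
    (h : resultOf (exec G Q loc (verify n) σ x) = some δ) (s : Fin n) : δ s = G.dist s x := by
  rw [exec_verify hf hQ] at h
  unfold resultOf at h
  dsimp only at h
  split_ifs at h with hbad
  have hok : ∀ y, D G y x ≠ ⊤ → ¬ Fails G σ y := fun y hy hfail => hbad ⟨y, hfail, hy⟩
  have hd : (σ x).d s = D G s x := by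
    refine le_antisymm ?_ (D_le_of_walkBound hG (hσ.d x s))
    rcases eq_or_ne (D G s x) ⊤ with htop | htop
    · rw [htop]; exact le_top
    -- The estimates do not exceed the lengths of the walks from `s` to ancestors of `x`.
    have key : ∀ m y, D G y x ≠ ⊤ → (σ y).d s ≤ bf G m s y := by
      intro m
      induction m with
      | zero =>
        intro y hy
        unfold bf
        split_ifs with hsy
        · subst hsy
          by_contra hc
          exact hok s hy (Or.inl hc)
        · exact le_top
      | succ m ih =>
        intro y hy
        rcases bf_succ_cases G m s y with h1 | ⟨z, h1⟩
        · rw [h1]; exact ih y hy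
        · rw [h1]
          rcases eq_or_ne (wt G z y) ⊤ with hw | hw
          · rw [hw, add_top]; exact le_top
          · have hz : D G z x ≠ ⊤ := ne_top_of_le_ne_top
              (WithTop.add_ne_top.2 ⟨ne_top_of_le_ne_top hw (D_le_wt hG z y), hy⟩)
              (D_triangle hG z y x)
            calc (σ y).d s ≤ (σ z).d s + wt G z y := by
                  by_contra hc
                  exact hok y hy (Or.inr ⟨s, z, not_le.1 hc⟩)
              _ ≤ bf G m s z + wt G z y := by gcongr; exact ih z hz
    exact key n x (by rw [D_self hG]; exact WithTop.zero_ne_top)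
  rw [Option.some.injEq] at h
  rw [← h, ← dist_eq_D hG, ← hd]

lemma result_simultaneous (hG : G.NoNegativeCycle) (hs : G.StronglyConnected) (σ : Fin n → Mem n)
    (x y : Fin n) (h : (resultOf (exec G Q loc (verify n) σ x)).isSome) :
    (resultOf (exec G Q loc (verify n) σ y)).isSome := by
  have hD : ∀ a b, D G a b ≠ ⊤ := fun a b => by
    obtain ⟨m, ℓ, hw⟩ := hs a b
    exact D_ne_top hG hw
  rw [exec_verify hf hQ] at h ⊢
  unfold resultOf at h ⊢
  simp only [hD, ne_eq, not_false_eq_true, and_true] at h ⊢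
  split_ifs at h ⊢ with h1
  · simp at h
  · rfl

lemma result_isSome (hG : G.NoNegativeCycle) {σ : Fin n → Mem n}
    (hσ : ∀ x s, (σ x).d s = D G s x) (x : Fin n) :
    (resultOf (exec G Q loc (verify n) σ x)).isSome := by
  rw [exec_verify hf hQ]
  unfold resultOf
  dsimp only
  rw [if_neg]
  · rfl
  · rintro ⟨y, h | ⟨s, z, h⟩, -⟩
    · rw [hσ, D_self hG] at h; exact h le_rfl
    · rw [hσ, hσ] at h
      exact absurd (D_le_add_wt hG s z y) (not_le.2 h)

end Verification

/-! ### The filtered broadcast -/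

section Filter

variable {n : ℕ} (G : Network n) (U : Fin n → ℕ) (β : Fin n → Fin n → WithTop ℝ)

/-- The minimum of `β s c` plus the distance from `c` to `x` over the centers `c` of rank less
than `θ`. -/
def through (θ : ℕ) (s x : Fin n) : WithTop ℝ :=
  Finset.univ.inf fun c => if U c < θ then β s c + D G c x else ⊤

/-- The token for the source `s` and the center `c` improves upon the centers of rank less than `θ`
at `y`, so that `y` forwards it. -/
def Passes (θ : ℕ) (s c y : Fin n) : Prop := β s c + D G c y < through G U β θ s y

/-- The token for `s` and `c` is forwarded from `c` to `x` over at most `m` edges. -/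
def Reaches (θ : ℕ) (s c : Fin n) : ℕ → Fin n → Prop
  | 0 => fun x => x = c
  | m + 1 => fun x => Reaches θ s c m x ∨
      ∃ y, G.Adj y x ∧ Reaches θ s c m y ∧ Passes G U β θ s c y

/-- The number of edges over which the token for `s` and `c` comes to `x`; it is `0` if it does
not. -/
def hops (θ : ℕ) (s c x : Fin n) : ℕ := sInf {m | Reaches G U β θ s c m x}

variable {G U β} {θ : ℕ} {s c x : Fin n}

lemma through_le {c : Fin n} (hc : U c < θ) : through G U β θ s x ≤ β s c + D G c x := by
  refine (Finset.inf_le (Finset.mem_univ c)).trans ?_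
  rw [if_pos hc]

lemma through_anti {θ' : ℕ} (h : θ ≤ θ') : through G U β θ' s x ≤ through G U β θ s x := by
  refine Finset.le_inf fun c _ => ?_
  split_ifs with hc
  · exact through_le (hc.trans_le h)
  · exact le_top

lemma through_le_add_wt (hG : G.NoNegativeCycle) (y : Fin n) :
    through G U β θ s x ≤ through G U β θ s y + wt G y x := by
  obtain ⟨c, -, hc⟩ := Finset.exists_mem_eq_inf Finset.univ ⟨x, Finset.mem_univ x⟩
    (fun c => if U c < θ then β s c + D G c y else ⊤)
  rw [through, through, hc]
  split_ifs with hcθ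
  · refine (through_le hcθ).trans ?_
    rw [add_assoc]
    gcongr
    exact D_le_add_wt hG c y x
  · simp

lemma Reaches.hops {m : ℕ} (hx : Reaches G U β θ s c m x) :
    Reaches G U β θ s c (APSP.hops G U β θ s c x) x :=
  Nat.sInf_mem (s := {m | Reaches G U β θ s c m x}) ⟨m, hx⟩

lemma Reaches.hops_le {m : ℕ} (hx : Reaches G U β θ s c m x) : APSP.hops G U β θ s c x ≤ m :=
  Nat.sInf_le hx

lemma hops_self : hops G U β θ s c c = 0 := Nat.le_zero.1 (Nat.sInf_le rfl)

/-- The filter loses nothing: if a node on a shortest path from `c` does not forward the token,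
then it knows a better center, and so do all nodes behind it on the path. -/
lemma reaches_or_through_le (hG : G.NoNegativeCycle) (m : ℕ) (x : Fin n) :
    Reaches G U β θ s c m x ∨ through G U β θ s x ≤ β s c + bf G m c x := by
  induction m generalizing x with
  | zero =>
    by_cases hx : x = c
    · exact Or.inl hx
    · right
      rw [show bf G 0 c x = ⊤ from if_neg (Ne.symm hx), add_top]
      exact le_top
  | succ m ih =>
    rcases bf_succ_cases G m c x with h | ⟨y, h⟩
    · rw [h]
      exact (ih x).imp_left Or.inl
    · rcases eq_or_ne (wt G y x) ⊤ with hw | hw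
      · right; rw [h, hw, add_top, add_top]; exact le_top
      have ha : G.Adj y x := by
        by_contra ha; exact hw (wt_eq_top ha)
      by_cases hy : Reaches G U β θ s c m y ∧ Passes G U β θ s c y
      · exact Or.inl (Or.inr ⟨y, ha, hy⟩)
      · have hle : through G U β θ s y ≤ β s c + bf G m c y := by
          rcases ih y with h1 | h1
          · have h2 : through G U β θ s y ≤ β s c + D G c y := not_lt.1 fun h3 => hy ⟨h1, h3⟩
            exact h2.trans (by gcongr; exact D_le_bf hG m c y)
          · exact h1
        right
        rw [h, ← add_assoc]
        exact (through_le_add_wt hG y).trans (by gcongr)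

end Filter

/-! ### A run with favourable random choices -/

section Run

variable {n : ℕ} {G : Network n} {Q : ℕ} {loc : Fin n → Loc n}

/-- The rank of a node. -/
def rk (loc : Fin n → Loc n) (x : Fin n) : ℕ := (loc x).rank

/-- The nodes of rank less than `2 ^ i` are the sources of level `i`, for which the preceding steps
of the level have computed `h`-hop distances. -/
def levelB (G : Network n) (U : Fin n → ℕ) (h i : ℕ) (s x : Fin n) : WithTop ℝ :=
  if U s < 2 ^ i then bf G h s x else ⊤

/-- The tokens that `x` forwards at time `t` of phase `j`. -/
def load (G : Network n) (U : Fin n → ℕ) (δ : Fin n → Fin n → ℕ) (β : Fin n → Fin n → WithTop ℝ)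
    (j : ℕ) (x : Fin n) (t : ℕ) : Finset (Key n) :=
  Finset.univ.filter fun k => (2 ^ j / 2 ≤ U k.2 ∧ U k.2 < 2 ^ j) ∧
    Passes G U β (2 ^ j / 2) k.1 k.2 x ∧ δ k.2 k.1 + hops G U β (2 ^ j / 2) k.1 k.2 x = t

/-- The random choices with which an attempt succeeds. -/
structure Good (G : Network n) (U : Fin n → ℕ) (δ : Fin n → Fin n → ℕ) (L Q τ : ℕ) (h : ℕ → ℕ) :
    Prop where
  rank_lt : ∀ s, U s < 2 ^ L
  delay_le : ∀ c s, δ c s + n ≤ τ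
  slot_le : ∀ u, (Finset.univ.filter fun s => U s = u).card ≤ Q
  hit : ∀ i ≤ L, ∀ s v, bf G (h i) s v ≠ D G s v → ∃ c ∈ relays G (h i) s v, U c < 2 ^ i / 2
  load_le : ∀ i ≤ L, ∀ j < i, ∀ x, ∀ t < τ, (load G U δ (levelB G U (h i) i) j x t).card ≤ Q

section
variable (hf : Fits G loc)
include hf

lemma exec_bfStep {u m : ℕ} (hu : (Finset.univ.filter fun s => rk loc s = u).card ≤ Q)
    {σ : Fin n → Mem n} (hσ : ∀ x s, (σ x).cur s = if rk loc s = u then bf G m s x else ⊤) :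
    bfStep.exec G Q loc σ = fun x => { σ x with
      cur := fun s => if rk loc s = u then bf G (m + 1) s x else ⊤ } := by
  funext x
  rw [Step.exec_eq]
  have h : ∀ y s, received G Q loc bfStep σ x y (s, s) + (loc x).wt y =
      if rk loc s = u then bf G m s y + wt G y x else ⊤ := by
    intro y s
    rw [received_eq, hf.wt]
    · by_cases ha : G.Adj y x
      · simp only [ha, if_true, bfStep, hσ]
        split_ifs <;> simp
      · simp [wt_eq_top ha]
    · intro _
      refine (Finset.card_le_card (t := (Finset.univ.filter fun s => rk loc s = u).image
        fun s => (s, s)) fun k hk => ?_).trans (Finset.card_image_le.trans hu)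
      simp only [bfStep, hσ, Finset.mem_filter, ne_eq, ite_eq_right_iff, not_forall] at hk
      obtain ⟨-, h1, h2, -⟩ := hk
      simp only [Finset.mem_image, Finset.mem_filter, Finset.mem_univ, true_and]
      exact ⟨k.1, h2, Prod.ext rfl h1⟩
  change ({ σ x with cur := fun s => min ((σ x).cur s) (Finset.univ.inf fun y =>
    received G Q loc bfStep σ x y (s, s) + (loc x).wt y) } : Mem n) = _
  simp only [h, hσ]
  congr 1
  funext s
  split_ifs
  · rfl
  · simp

lemma exec_slot {h u : ℕ} (hu : (Finset.univ.filter fun s => rk loc s = u).card ≤ Q)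
    (σ : Fin n → Mem n) :
    exec G Q loc (slot h u) σ = fun x => { σ x with
      cur := fun s => if rk loc s = u then bf G h s x else ⊤
      B := fun s => min ((σ x).B s) (if rk loc s = u then bf G h s x else ⊤) } := by
  have key : ∀ m, exec G Q loc (slotInit u :: List.replicate m bfStep) σ = fun x => { σ x with
      cur := fun s => if rk loc s = u then bf G m s x else ⊤ } := by
    intro m
    induction m with
    | zero =>
      rw [List.replicate_zero, exec_cons, exec_nil, slotInit, exec_silent]
      funext x
      congr 1
      funext s
      rw [hf.id]
      by_cases hs : s = x
      · subst hs; simp [bf, rk]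
      · simp [bf, hs]
    | succ m ih =>
      rw [List.replicate_succ', ← List.cons_append, exec_append, ih, exec_cons, exec_nil,
        exec_bfStep hf hu (m := m) fun x s => rfl]
  rw [slot, ← List.cons_append, exec_append, key, exec_cons, exec_nil, slotEnd, exec_silent]

lemma exec_slots {h i : ℕ} (hu : ∀ u, (Finset.univ.filter fun s => rk loc s = u).card ≤ Q)
    (σ : Fin n → Mem n) (hB : ∀ x s, (σ x).B s = ⊤) :
    ∀ x, (exec G Q loc ((List.range (2 ^ i)).flatMap (slot h)) σ x).d = (σ x).d ∧
      (exec G Q loc ((List.range (2 ^ i)).flatMap (slot h)) σ x).T = (σ x).T ∧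
      ∀ s, (exec G Q loc ((List.range (2 ^ i)).flatMap (slot h)) σ x).B s =
        levelB G (rk loc) h i s x := by
  refine exec_flatMap_range G Q loc (slot h) (2 ^ i) (fun m σ' => ∀ x, (σ' x).d = (σ x).d ∧
    (σ' x).T = (σ x).T ∧ ∀ s, (σ' x).B s = if rk loc s < m then bf G h s x else ⊤) ?_ σ
    (fun x => ⟨rfl, rfl, fun s => by simp [hB]⟩)
  intro m _ σ' hσ' x
  rw [exec_slot hf (hu m)]
  refine ⟨(hσ' x).1, (hσ' x).2.1, fun s => ?_⟩
  dsimp only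
  rw [(hσ' x).2.2 s]
  rcases lt_trichotomy (rk loc s) m with h1 | h1 | h1
  · simp [h1, h1.ne, h1.trans (Nat.lt_succ_self m)]
  · simp [h1]
  · have h2 : ¬ rk loc s < m := by omega
    have h3 : ¬ rk loc s < m + 1 := by omega
    simp [h1.ne', h2, h3]

end

section Phase

variable (G loc) in
/-- At time `t` of phase `j`, the node `x` has the token `k`. -/
def Known (β : Fin n → Fin n → WithTop ℝ) (j t : ℕ) (k : Key n) (x : Fin n) : Prop :=
  (2 ^ j / 2 ≤ rk loc k.2 ∧ rk loc k.2 < 2 ^ j) ∧ (x = k.2 ∨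
    (∃ m, Reaches G (rk loc) β (2 ^ j / 2) k.1 k.2 m x) ∧
      (loc k.2).delay k.1 + hops G (rk loc) β (2 ^ j / 2) k.1 k.2 x ≤ t)

variable (G loc) in
/-- At time `t` of phase `j`, the node `y` forwards the token `k`. -/
def Sends (β : Fin n → Fin n → WithTop ℝ) (j t : ℕ) (k : Key n) (y : Fin n) : Prop :=
  (2 ^ j / 2 ≤ rk loc k.2 ∧ rk loc k.2 < 2 ^ j) ∧
    (∃ m, Reaches G (rk loc) β (2 ^ j / 2) k.1 k.2 m y) ∧
    Passes G (rk loc) β (2 ^ j / 2) k.1 k.2 y ∧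
    (loc k.2).delay k.1 + hops G (rk loc) β (2 ^ j / 2) k.1 k.2 y = t

variable {β : Fin n → Fin n → WithTop ℝ} {j : ℕ}

lemma Known.succ {t : ℕ} {k : Key n} {x : Fin n} (h : Known G loc β j t k x) :
    Known G loc β j (t + 1) k x :=
  ⟨h.1, h.2.imp_right fun h => ⟨h.1, h.2.trans (Nat.le_succ t)⟩⟩

/-- A node gets a token in the step after the first of its in-neighbours that forward it has got
it. -/
lemma known_succ_iff {t : ℕ} {k : Key n} {x : Fin n} (h : ¬ Known G loc β j t k x) :
    Known G loc β j (t + 1) k x ↔ ∃ y, G.Adj y x ∧ Sends G loc β j t k y := by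
  obtain ⟨s, c⟩ := k
  constructor
  · rintro ⟨hc, hx⟩
    have hxc : x ≠ c := fun hxc => h ⟨hc, Or.inl hxc⟩
    obtain ⟨⟨m, hm⟩, ht⟩ := hx.resolve_left hxc
    dsimp only at hm ht hc
    have hlt : t < (loc c).delay s + hops G (rk loc) β (2 ^ j / 2) s c x := by
      by_contra hle
      exact h ⟨hc, Or.inr ⟨⟨m, hm⟩, not_lt.1 hle⟩⟩
    have hr := hm.hops
    rcases hh : hops G (rk loc) β (2 ^ j / 2) s c x with _ | b
    · rw [hh] at hr
      exact absurd hr hxc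
    · rw [hh] at hr hlt ht
      rcases hr with hr | ⟨y, ha, hy, hp⟩
      · have := hr.hops_le; omega
      · refine ⟨y, ha, hc, ⟨b, hy⟩, hp, ?_⟩
        dsimp only
        have h1 := hy.hops_le
        have h2 : Reaches G (rk loc) β (2 ^ j / 2) s c (hops G (rk loc) β (2 ^ j / 2) s c y + 1) x :=
          Or.inr ⟨y, ha, hy.hops, hp⟩
        have h3 := h2.hops_le
        omega
  · rintro ⟨y, ha, hc, ⟨m, hm⟩, hp, ht⟩
    dsimp only at hm hp ht hc
    have h2 : Reaches G (rk loc) β (2 ^ j / 2) s c (hops G (rk loc) β (2 ^ j / 2) s c y + 1) x :=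
      Or.inr ⟨y, ha, hm.hops, hp⟩
    refine ⟨hc, Or.inr ⟨⟨_, h2⟩, ?_⟩⟩
    have := h2.hops_le
    dsimp only
    omega

variable (G loc) in
/-- The configuration at time `t` of phase `j`. -/
structure TokInv (β : Fin n → Fin n → WithTop ℝ) (j t : ℕ) (σ : Fin n → Mem n) : Prop where
  d : ∀ x c, rk loc c < 2 ^ j → (σ x).d c = D G c x
  B : ∀ x s, (σ x).B s = β s x
  T : ∀ x s, (σ x).T s = through G (rk loc) β (2 ^ j / 2) s x
  tokV : ∀ x k, (σ x).tokV k = if Known G loc β j t k x then β k.1 k.2 else ⊤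
  tokT : ∀ x k, (σ x).tokV k ≠ ⊤ →
    (σ x).tokT k = (loc k.2).delay k.1 + hops G (rk loc) β (2 ^ j / 2) k.1 k.2 x

lemma TokInv.out {t : ℕ} {σ : Fin n → Mem n} (h : TokInv G loc β j t σ) (y : Fin n) (k : Key n) :
    (tokStep t).out (loc y) (σ y) k = if Sends G loc β j t k y then β k.1 k.2 else ⊤ := by
  unfold tokStep
  dsimp only
  by_cases hk : Known G loc β j t k y
  · have hV : (σ y).tokV k = β k.1 k.2 := by rw [h.tokV, if_pos hk]
    rcases eq_or_ne (β k.1 k.2) ⊤ with hβ | hβ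
    · rw [hV, hβ]; simp
    · rw [h.tokT y k (hV ▸ hβ), hV, h.d y k.2 hk.1.2, h.T]
      have hreach : ∃ m, Reaches G (rk loc) β (2 ^ j / 2) k.1 k.2 m y :=
        hk.2.elim (fun h => ⟨0, h⟩) fun h => h.1
      congr 1
      exact propext ⟨fun h => ⟨hk.1, hreach, h.2, h.1⟩, fun h => ⟨h.2.2.2, h.2.2.1⟩⟩
  · have hS : ¬ Sends G loc β j t k y := fun hS => hk ⟨hS.1, Or.inr ⟨hS.2.1, hS.2.2.2.le⟩⟩
    rw [h.tokV, if_neg hk, if_neg hS, ite_self]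

lemma TokInv.succ {t : ℕ} {σ : Fin n → Mem n} (h : TokInv G loc β j t σ)
    (hQ : ∀ y, (load G (rk loc) (fun c => (loc c).delay) β j y t).card ≤ Q) :
    TokInv G loc β j (t + 1) ((tokStep t).exec G Q loc σ) := by
  have hrec : ∀ x y k, received G Q loc (tokStep t) σ x y k =
      if G.Adj y x ∧ Sends G loc β j t k y then β k.1 k.2 else ⊤ := by
    intro x y k
    rw [received_eq]
    · rw [h.out, ite_and]
    · intro _
      refine (Finset.card_le_card fun k hk => ?_).trans (hQ y)
      simp only [h.out, Finset.mem_filter, ne_eq, ite_eq_right_iff, not_forall] at hk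
      obtain ⟨-, hS, -⟩ := hk
      simp only [load, Finset.mem_filter, Finset.mem_univ, true_and]
      exact ⟨hS.1, hS.2.2⟩
  have hinf : ∀ x k, (Finset.univ.inf fun y => received G Q loc (tokStep t) σ x y k) =
      if ∃ y, G.Adj y x ∧ Sends G loc β j t k y then β k.1 k.2 else ⊤ := by
    intro x k
    simp only [hrec]
    split_ifs with hy
    · obtain ⟨y, hy⟩ := hy
      refine le_antisymm ((Finset.inf_le (Finset.mem_univ y)).trans (by rw [if_pos hy]))
        (Finset.le_inf fun z _ => ?_)
      split_ifs
      · exact le_rfl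
      · exact le_top
    · push Not at hy
      refine top_le_iff.1 (Finset.le_inf fun z _ => ?_)
      rw [if_neg (fun hz => hy z hz.1 hz.2)]
  have hV : ∀ x k, ((tokStep t).exec G Q loc σ x).tokV k = if (σ x).tokV k = ⊤ then
      (if ∃ y, G.Adj y x ∧ Sends G loc β j t k y then β k.1 k.2 else ⊤) else (σ x).tokV k := by
    intro x k
    rw [← hinf]
    rfl
  have hT : ∀ x k, ((tokStep t).exec G Q loc σ x).tokT k =
      if (σ x).tokV k = ⊤ then t + 1 else (σ x).tokT k := fun x k => rfl
  have hV' : ∀ x k, ((tokStep t).exec G Q loc σ x).tokV k =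
      if Known G loc β j (t + 1) k x then β k.1 k.2 else ⊤ := by
    intro x k
    rw [hV, h.tokV]
    by_cases hk : Known G loc β j t k x
    · rw [if_pos hk, if_pos hk.succ]
      by_cases hβ : β k.1 k.2 = ⊤ <;> simp [hβ]
    · rw [if_neg hk, if_pos rfl]
      congr 1
      exact propext (known_succ_iff hk).symm
  refine ⟨h.d, h.B, h.T, hV', fun x k hne => ?_⟩
  rw [hT]
  split_ifs with htop
  · rw [hV'] at hne
    have hk1 : Known G loc β j (t + 1) k x := by
      by_contra hk; exact hne (if_neg hk)
    rw [if_pos hk1] at hne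
    have hk : ¬ Known G loc β j t k x := fun hk => by
      rw [h.tokV, if_pos hk] at htop; exact hne htop
    have hxk : x ≠ k.2 := fun hx => hk ⟨hk1.1, Or.inl hx⟩
    have h1 := hk1.2.resolve_left hxk
    have h2 : ¬ _ ≤ t := fun h2 => hk ⟨hk1.1, Or.inr ⟨h1.1, h2⟩⟩
    have := h1.2
    omega
  · exact h.tokT x k htop

variable (hf : Fits G loc)
include hf

lemma TokInv.init {σ : Fin n → Mem n} (hd : ∀ x c, rk loc c < 2 ^ j → (σ x).d c = D G c x)
    (hB : ∀ x s, (σ x).B s = β s x)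
    (hT : ∀ x s, (σ x).T s = through G (rk loc) β (2 ^ j / 2) s x) :
    TokInv G loc β j 0 ((tokInit j).exec G Q loc σ) := by
  rw [tokInit, exec_silent]
  refine ⟨hd, hB, hT, fun x k => ?_, fun x k hne => ?_⟩
  · dsimp only
    rw [hf.id]
    by_cases hx : k.2 = x
    · subst hx
      simp only [true_and, Known, true_or, and_true]
      rw [hB]
      rfl
    · have hk : ¬ Known G loc β j 0 k x := by
        rintro ⟨-, h | ⟨⟨m, hm⟩, h⟩⟩
        · exact hx h.symm
        · have h0 : hops G (rk loc) β (2 ^ j / 2) k.1 k.2 x = 0 := by omega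
          have := hm.hops
          rw [h0] at this
          exact hx (this : x = k.2).symm
      rw [if_neg hk, if_neg fun h => hx h.1]
  · dsimp only at hne ⊢
    rw [hf.id] at hne ⊢
    have hx : k.2 = x := by
      by_contra hx; exact hne (if_neg fun h => hx h.1)
    subst hx
    rw [if_pos rfl, hops_self, add_zero]

lemma exec_phase {τ : ℕ} (hG : G.NoNegativeCycle)
    (hQ : ∀ x, ∀ t < τ, (load G (rk loc) (fun c => (loc c).delay) β j x t).card ≤ Q)
    (hτ : ∀ c s, (loc c).delay s + n ≤ τ) {σ : Fin n → Mem n}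
    (hd : ∀ x c, rk loc c < 2 ^ j → (σ x).d c = D G c x)
    (hB : ∀ x s, (σ x).B s = β s x)
    (hT : ∀ x s, (σ x).T s = through G (rk loc) β (2 ^ j / 2) s x) (x : Fin n) :
    (exec G Q loc (phase τ j) σ x).d = (σ x).d ∧ (exec G Q loc (phase τ j) σ x).B = (σ x).B ∧
      ∀ s, (exec G Q loc (phase τ j) σ x).T s = through G (rk loc) β (2 ^ j) s x := by
  have key : ∀ t ≤ τ, TokInv G loc β j t
      (exec G Q loc (tokInit j :: (List.range t).map tokStep) σ) ∧
      ∀ x, (exec G Q loc (tokInit j :: (List.range t).map tokStep) σ x).d = (σ x).d ∧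
        (exec G Q loc (tokInit j :: (List.range t).map tokStep) σ x).B = (σ x).B := by
    intro t
    induction t with
    | zero => exact fun _ => ⟨TokInv.init hf hd hB hT, fun x => ⟨rfl, rfl⟩⟩
    | succ t ih =>
      intro ht
      specialize ih (by omega)
      rw [List.range_succ, List.map_append, ← List.cons_append, exec_append]
      exact ⟨ih.1.succ fun y => hQ y t ht, fun x => ih.2 x⟩
  obtain ⟨hinv, hsame⟩ := key τ le_rfl
  rw [phase, ← List.cons_append, exec_append, exec_cons, exec_nil, tokEnd, exec_silent]
  refine ⟨(hsame x).1, (hsame x).2, fun s => ?_⟩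
  dsimp only
  simp only [hinv.T, hinv.tokV]
  have hhalf : 2 ^ j / 2 ≤ 2 ^ j := Nat.div_le_self _ _
  refine le_antisymm (Finset.le_inf fun c _ => ?_)
    (le_min (through_anti hhalf) (Finset.le_inf fun c _ => ?_))
  · split_ifs with hc
    · rcases Nat.lt_or_ge (rk loc c) (2 ^ j / 2) with hc' | hc'
      · exact (min_le_left _ _).trans (through_le hc')
      · rcases reaches_or_through_le (U := rk loc) (β := β) (θ := 2 ^ j / 2) (s := s) (c := c) hG n x
          with h1 | h1
        · refine (min_le_right _ _).trans ((Finset.inf_le (Finset.mem_univ c)).trans ?_)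
          have hk : Known G loc β j τ (s, c) x :=
            ⟨⟨hc', hc⟩, Or.inr ⟨⟨n, h1⟩, (Nat.add_le_add_left h1.hops_le _).trans (hτ c s)⟩⟩
          rw [if_pos hk, hinv.d x c hc]
        · exact (min_le_left _ _).trans h1
    · exact le_top
  · split_ifs with hk
    · rw [hinv.d x c hk.1.2]
      exact through_le hk.1.2
    · rw [top_add]; exact le_top

end Phase

lemma exec_level {L τ i : ℕ} {h : ℕ → ℕ} (hG : G.NoNegativeCycle) (hf : Fits G loc)
    (hgood : Good G (rk loc) (fun c => (loc c).delay) L Q τ h) (hi : i ≤ L)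
    {σ : Fin n → Mem n} (hd : ∀ x c, rk loc c < 2 ^ i / 2 → (σ x).d c = D G c x) (x s : Fin n)
    (hs : rk loc s < 2 ^ i) : (exec G Q loc (level (h i) τ i) σ x).d s = D G s x := by
  rw [level, exec_cons, exec_append, exec_append]
  have hB := exec_slots hf (h := h i) (i := i) hgood.slot_le (levelInit.exec G Q loc σ)
    (fun _ _ => rfl)
  generalize hσ1 : exec G Q loc ((List.range (2 ^ i)).flatMap (slot (h i)))
    (levelInit.exec G Q loc σ) = σ1 at hB ⊢
  have hT := exec_flatMap_range G Q loc (phase τ) i (fun j σ' => ∀ x, (σ' x).d = (σ1 x).d ∧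
    (∀ s, (σ' x).B s = levelB G (rk loc) (h i) i s x) ∧
    ∀ s, (σ' x).T s = through G (rk loc) (levelB G (rk loc) (h i) i) (2 ^ j / 2) s x) (by
      intro j hj σ' hσ' x
      have hpow : 2 ^ (j + 1) / 2 = 2 ^ j := by rw [pow_succ]; omega
      have hle : 2 ^ (j + 1) ≤ 2 ^ i := Nat.pow_le_pow_right (by norm_num) hj
      have := exec_phase (τ := τ) hf hG (hgood.load_le i hi j hj) hgood.delay_le (σ := σ')
        (fun x c hc => by
          rw [(hσ' x).1, (hB x).1]
          exact hd x c (by omega))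
        (fun x => (hσ' x).2.1) (fun x => (hσ' x).2.2) x
      rw [hpow]
      exact ⟨this.1.trans (hσ' x).1, fun s => by rw [this.2.1, (hσ' x).2.1], this.2.2⟩) σ1 (by
      intro x
      refine ⟨rfl, (hB x).2.2, fun s => ?_⟩
      rw [(hB x).2.1]
      simp [through, levelInit, exec_silent]) x
  rw [exec_cons, exec_nil, levelEnd, exec_silent]
  dsimp only
  rw [hT.2.1, hT.2.2, levelB, if_pos hs]
  apply le_antisymm
  · by_cases hv : bf G (h i) s x = D G s x
    · exact (min_le_left _ _).trans hv.le
    · obtain ⟨c, hc, hUc⟩ := hgood.hit i hi s x hv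
      refine (min_le_right _ _).trans ((through_le hUc).trans ?_)
      rw [levelB, if_pos hs]
      exact (Finset.mem_filter.1 hc).2.le
  · refine le_min (D_le_bf hG _ _ _) (Finset.le_inf fun c _ => ?_)
    split_ifs
    · rw [levelB, if_pos hs]
      exact (D_triangle hG s c x).trans (by gcongr; exact D_le_bf hG _ _ _)
    · exact le_top

/-- With favourable random choices, all distances are correct after the last level. -/
lemma exec_levels {L τ : ℕ} {h : ℕ → ℕ} (hG : G.NoNegativeCycle) (hf : Fits G loc)
    (hgood : Good G (rk loc) (fun c => (loc c).delay) L Q τ h) (σ : Fin n → Mem n) (x s : Fin n) :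
    (exec G Q loc ((List.range (L + 1)).flatMap fun i => level (h i) τ i) σ x).d s = D G s x := by
  refine exec_flatMap_range G Q loc (fun i => level (h i) τ i) (L + 1)
    (fun i σ' => ∀ x s, rk loc s < 2 ^ i / 2 → (σ' x).d s = D G s x) ?_ σ ?_ x s ?_
  · intro i hi σ' hσ' x s hs
    refine exec_level hG hf hgood (by omega) hσ' x s ?_
    rw [pow_succ] at hs
    omega
  · intro x s hs
    norm_num at hs
  · have := hgood.rank_lt s
    rw [pow_succ]
    omega

end Run

/-! ### Counting favourable choices -/

section Prob

/-- The probability of an event under the uniform distribution on a finite type. -/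
def prob {α : Type*} (p : α → Prop) : ℝ := (Nat.card {a // p a} : ℝ) / Nat.card α

variable {α β ι : Type*} [Fintype α] [Fintype β] [Fintype ι]

lemma prob_eq (p : α → Prop) [DecidablePred p] :
    prob p = ((Finset.univ.filter p).card : ℝ) / Fintype.card α := by
  rw [prob, Nat.card_eq_fintype_card, Nat.card_eq_fintype_card, Fintype.card_subtype]

lemma prob_mono {p q : α → Prop} (h : ∀ a, p a → q a) : prob p ≤ prob q := by
  simp only [prob_eq]
  gcongr
  exact h _

lemma prob_or_le (p q : α → Prop) : prob (fun a => p a ∨ q a) ≤ prob p + prob q := by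
  simp only [prob_eq]
  rw [← add_div, Finset.filter_or]
  gcongr
  exact_mod_cast Finset.card_union_le _ _

lemma prob_exists_le {p : ι → α → Prop} {ε : ℝ} (h : ∀ i, prob (p i) ≤ ε) :
    prob (fun a => ∃ i, p i a) ≤ Fintype.card ι * ε := by
  have h1 : prob (fun a => ∃ i, p i a) ≤ ∑ i, prob (p i) := by
    simp only [prob_eq]
    rw [← Finset.sum_div]
    gcongr
    have : Finset.univ.filter (fun a => ∃ i, p i a) =
        Finset.univ.biUnion fun i => Finset.univ.filter (p i) := by
      ext a; simp
    rw [this]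
    exact_mod_cast Finset.card_biUnion_le
  refine h1.trans ((Finset.sum_le_sum fun i _ => h i).trans ?_)
  simp

lemma prob_prod_le {p : α → β → Prop} {ε : ℝ} (hε : 0 ≤ ε) (h : ∀ a, prob (p a) ≤ ε) :
    prob (fun x : α × β => p x.1 x.2) ≤ ε := by
  rcases isEmpty_or_nonempty (α × β) with h0 | h0
  · simp [prob, hε]
  obtain ⟨a0, b0⟩ := h0
  have hα : (0 : ℝ) < Fintype.card α := by exact_mod_cast Fintype.card_pos_iff.2 ⟨a0⟩
  have hβ : (0 : ℝ) < Fintype.card β := by exact_mod_cast Fintype.card_pos_iff.2 ⟨b0⟩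
  simp only [prob_eq] at h ⊢
  have hcard : (Finset.univ.filter fun x : α × β => p x.1 x.2).card =
      ∑ a, (Finset.univ.filter (p a)).card := by
    simp only [Finset.card_filter, Fintype.sum_prod_type]
  rw [hcard, Fintype.card_prod, Nat.cast_mul, div_le_iff₀ (by positivity), Nat.cast_sum]
  calc ∑ a, ((Finset.univ.filter (p a)).card : ℝ) ≤ ∑ _a : α, ε * Fintype.card β :=
        Finset.sum_le_sum fun a _ => (div_le_iff₀ hβ).1 (h a)
    _ = ε * (Fintype.card α * Fintype.card β) := by
        rw [Finset.sum_const, Finset.card_univ, nsmul_eq_mul]; ring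

lemma prob_fst_le (p : α → Prop) : prob (fun x : α × β => p x.1) ≤ prob p := by
  rcases isEmpty_or_nonempty β with h0 | h0
  · simp only [prob_eq, Fintype.card_eq_zero, Nat.cast_zero, div_zero]
    positivity
  have hβ : (0 : ℝ) < Fintype.card β := by exact_mod_cast Fintype.card_pos
  simp only [prob_eq]
  have : (Finset.univ.filter fun x : α × β => p x.1) = Finset.univ.filter p ×ˢ Finset.univ := by
    ext x; simp
  rw [this, Finset.card_product, Fintype.card_prod, Finset.card_univ, Nat.cast_mul, Nat.cast_mul,
    mul_div_mul_right _ _ hβ.ne']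

lemma prob_equiv (e : α ≃ β) (p : β → Prop) : prob (fun a => p (e a)) = prob p := by
  simp only [prob_eq]
  rw [Fintype.card_congr e]
  congr 2
  refine Finset.card_bij (fun a _ => e a) (by simp) (fun a _ b _ h => e.injective h) fun b hb =>
    ⟨e.symm b, by simpa using hb, by simp⟩

variable {N : ℕ}

/-- Independent coordinates that are each in a set of density at most `q`. -/
lemma prob_forall_mem_le (A : Finset ι) (W : ι → Finset (Fin N)) {q : ℝ}
    (hW : ∀ a ∈ A, ((W a).card : ℝ) ≤ q * N) (hN : 0 < N) :
    prob (fun X : ι → Fin N => ∀ a ∈ A, X a ∈ W a) ≤ q ^ A.card := by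
  have hN' : (0 : ℝ) < N := by exact_mod_cast hN
  have hset : (Finset.univ.filter fun X : ι → Fin N => ∀ a ∈ A, X a ∈ W a) =
      Fintype.piFinset fun a => if a ∈ A then W a else Finset.univ := by
    ext X
    simp only [Finset.mem_filter, Finset.mem_univ, true_and, Fintype.mem_piFinset]
    refine forall_congr' fun a => ?_
    split_ifs with h <;> simp [h]
  simp only [prob_eq]
  rw [hset, Fintype.card_piFinset, Fintype.card_fun, Fintype.card_fin,
    div_le_iff₀ (by positivity)]
  push_cast
  rw [← Finset.card_univ, ← Finset.prod_const (N : ℝ), ← Finset.prod_const q,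
    ← Finset.prod_filter_mul_prod_filter_not Finset.univ (· ∈ A),
    ← Finset.prod_filter_mul_prod_filter_not Finset.univ (· ∈ A) (fun _ => (N : ℝ)),
    ← mul_assoc, Finset.filter_mem_eq_inter, Finset.univ_inter, ← Finset.prod_mul_distrib]
  refine mul_le_mul ?_ ?_ (by positivity) (Finset.prod_nonneg fun a ha =>
    (Nat.cast_nonneg _).trans (hW a ha))
  · refine Finset.prod_le_prod (fun a _ => by positivity) fun a ha => ?_
    rw [if_pos ha]; exact hW a ha
  · refine Finset.prod_le_prod (fun a _ => by positivity) fun a ha => ?_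
    rw [if_neg (Finset.mem_filter.1 ha).2]; simp

/-- At least `m` of the coordinates in `F` take prescribed values. -/
lemma prob_many_le (F : Finset ι) (r : ι → ℕ) (t m : ℕ) (hN : 0 < N) :
    prob (fun X : ι → Fin N => m ≤ (F.filter fun a => (X a : ℕ) + r a = t).card) ≤
      (F.card : ℝ) ^ m / (m.factorial * (N : ℝ) ^ m) := by
  have hN' : (0 : ℝ) < N := by exact_mod_cast hN
  have h1 : prob (fun X : ι → Fin N => m ≤ (F.filter fun a => (X a : ℕ) + r a = t).card) ≤
      prob (fun X : ι → Fin N => ∃ A : (F.powersetCard m : Finset (Finset ι)),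
        ∀ a ∈ A.1, (X a : ℕ) + r a = t) := by
    refine prob_mono fun X hX => ?_
    obtain ⟨A, hA, hc⟩ := Finset.exists_subset_card_eq hX
    refine ⟨⟨A, Finset.mem_powersetCard.2 ⟨hA.trans (Finset.filter_subset _ _), hc⟩⟩, fun a ha => ?_⟩
    exact (Finset.mem_filter.1 (hA ha)).2
  have h2 : ∀ A : (F.powersetCard m : Finset (Finset ι)),
      prob (fun X : ι → Fin N => ∀ a ∈ A.1, (X a : ℕ) + r a = t) ≤ (1 / N : ℝ) ^ m := by
    intro A
    have := prob_forall_mem_le (N := N) A.1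
      (fun a => Finset.univ.filter fun v : Fin N => (v : ℕ) + r a = t) (q := 1 / N) (by
        intro a _
        rw [one_div_mul_cancel hN'.ne']
        exact_mod_cast Finset.card_le_one.2 fun v hv w hw => by
          simp only [Finset.mem_filter, Finset.mem_univ, true_and] at hv hw
          exact Fin.ext (by omega)) hN
    rw [(Finset.mem_powersetCard.1 A.2).2] at this
    simpa using this
  refine h1.trans ((prob_exists_le h2).trans ?_)
  rw [Fintype.card_coe, Finset.card_powersetCard]
  have h3 := Nat.choose_le_pow_div (α := ℝ) m F.card
  calc (F.card.choose m : ℝ) * (1 / N) ^ m ≤ (F.card : ℝ) ^ m / m.factorial * (1 / N) ^ m := by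
        gcongr
    _ = _ := by rw [one_div, inv_pow, div_mul_eq_div_div, div_eq_mul_inv _ ((N : ℝ) ^ m)]

/-- An event that does not depend on the coordinate `c` is independent of it. -/
lemma prob_coord_and (c : ι) (S : Finset (Fin N)) (p : (ι → Fin N) → Prop)
    (hp : ∀ U a, p (Function.update U c a) ↔ p U) (hN : 0 < N) :
    prob (fun U => U c ∈ S ∧ p U) = (S.card : ℝ) / N * prob p := by
  have hN' : (0 : ℝ) < N := by exact_mod_cast hN
  have h : (Finset.univ.filter fun U : ι → Fin N => U c ∈ S ∧ p U).card * N =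
      S.card * (Finset.univ.filter p).card := by
    have h0 : (Finset.univ.filter fun U : ι → Fin N => U c ∈ S ∧ p U).card * N =
        ((Finset.univ.filter fun U : ι → Fin N => U c ∈ S ∧ p U) ×ˢ
          (Finset.univ : Finset (Fin N))).card := by
      rw [Finset.card_product, Finset.card_univ, Fintype.card_fin]
    rw [h0, ← Finset.card_product]
    refine Finset.card_nbij' (fun x => (x.1 c, Function.update x.1 c x.2))
      (fun x => (Function.update x.2 c x.1, x.2 c)) ?_ ?_ ?_ ?_
    · rintro ⟨U, b⟩ hx
      simp only [Finset.coe_product, Set.mem_prod, Finset.mem_coe, Finset.mem_filter,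
        Finset.mem_univ, true_and, and_true] at hx ⊢
      exact ⟨hx.1, (hp _ _).2 hx.2⟩
    · rintro ⟨a, V⟩ hx
      simp only [Finset.coe_product, Set.mem_prod, Finset.mem_coe, Finset.mem_filter,
        Finset.mem_univ, true_and, and_true] at hx ⊢
      exact ⟨by simpa using hx.1, (hp _ _).2 hx.2⟩
    · rintro ⟨U, b⟩ _; simp
    · rintro ⟨a, V⟩ _; simp
  have h' : ((Finset.univ.filter fun U : ι → Fin N => U c ∈ S ∧ p U).card : ℝ) * N =
      S.card * (Finset.univ.filter p).card := by exact_mod_cast h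
  simp only [prob_eq]
  rw [div_mul_div_comm, ← h', mul_comm (N : ℝ)]
  exact (mul_div_mul_right _ _ hN'.ne').symm

/-- In the order of the list, at least `R` nodes of rank in `[θ, 2 θ)` precede the first node of
rank less than `θ`. -/
def Precede (θ : ℕ) (U : ι → Fin N) : List ι → ℕ → Prop
  | _, 0 => True
  | [], _ + 1 => False
  | c :: l, R + 1 => (U c ∈ (Finset.univ.filter fun v : Fin N => θ ≤ v ∧ v < 2 * θ) ∧
      Precede θ U l R) ∨ (U c ∈ (Finset.univ.filter fun v : Fin N => 2 * θ ≤ v) ∧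
      Precede θ U l (R + 1))

omit [Fintype ι] in
lemma Precede.update {θ : ℕ} {U : ι → Fin N} {l : List ι} {R : ℕ} {c : ι} (hc : c ∉ l)
    (a : Fin N) : Precede θ (Function.update U c a) l R ↔ Precede θ U l R := by
  induction l generalizing R with
  | nil => cases R <;> rfl
  | cons b l ih =>
    cases R with
    | zero => simp [Precede]
    | succ R =>
      rw [List.mem_cons, not_or] at hc
      simp only [Precede, ih hc.2, Function.update_of_ne (Ne.symm hc.1)]

/-- Among the nodes of rank less than `2 θ`, each has rank less than `θ` with probability one half,
independently of the others. -/
lemma prob_precede_le {θ : ℕ} (hθ : 2 * θ ≤ N) (hN : 0 < N) (l : List ι) (hl : l.Nodup) (R : ℕ) :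
    prob (fun U : ι → Fin N => Precede θ U l R) ≤ (1 / 2 : ℝ) ^ R := by
  have hN' : (0 : ℝ) < N := by exact_mod_cast hN
  have hle1 : ∀ p : (ι → Fin N) → Prop, prob p ≤ 1 := fun p => by
    simp only [prob_eq]
    exact div_le_one_of_le₀ (by exact_mod_cast Finset.card_le_univ _) (by positivity)
  induction l generalizing R with
  | nil =>
    cases R with
    | zero => simpa using hle1 _
    | succ R =>
      have : prob (fun U : ι → Fin N => Precede θ U [] (R + 1)) = 0 := by
        rw [prob_eq, Finset.filter_false_of_mem (by simp [Precede])]; simp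
      rw [this]; positivity
  | cons c l ih =>
    cases R with
    | zero => simpa using hle1 _
    | succ R =>
      obtain ⟨hc, hl'⟩ := List.nodup_cons.1 hl
      have hS : ((Finset.univ.filter fun v : Fin N => θ ≤ v ∧ v < 2 * θ).card : ℝ) ≤ θ := by
        have : (Finset.univ.filter fun v : Fin N => θ ≤ (v : ℕ) ∧ (v : ℕ) < 2 * θ).card ≤
            (Finset.Ico θ (2 * θ)).card :=
          Finset.card_le_card_of_injOn (fun v => (v : ℕ)) (fun v hv => by simpa using hv)
            (fun v _ w _ h => Fin.ext h)
        rw [Nat.card_Ico] at this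
        exact_mod_cast this.trans (by omega)
      have hS' : ((Finset.univ.filter fun v : Fin N => 2 * θ ≤ v).card : ℝ) ≤ N - 2 * θ := by
        have : (Finset.univ.filter fun v : Fin N => 2 * θ ≤ (v : ℕ)).card ≤
            (Finset.Ico (2 * θ) N).card :=
          Finset.card_le_card_of_injOn (fun v => (v : ℕ)) (fun v hv => by simpa using hv)
            (fun v _ w _ h => Fin.ext h)
        rw [Nat.card_Ico] at this
        have h2 : ((N - 2 * θ : ℕ) : ℝ) = N - 2 * θ := by push_cast [Nat.cast_sub hθ]; ring
        rw [← h2]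
        exact_mod_cast this
      simp only [Precede]
      refine (prob_or_le _ _).trans ?_
      rw [prob_coord_and c _ _ (fun U a => Precede.update hc a) hN,
        prob_coord_and c _ _ (fun U a => Precede.update hc a) hN]
      have hsub : (0 : ℝ) ≤ N - 2 * θ := by
        have : ((2 * θ : ℕ) : ℝ) ≤ N := by exact_mod_cast hθ
        push_cast at this; linarith
      calc _ ≤ (θ : ℝ) / N * (1 / 2) ^ R + (N - 2 * θ) / N * (1 / 2) ^ (R + 1) := by
            gcongr
            · simp only [prob_eq]; positivity
            · exact ih hl' R
            · simp only [prob_eq]; positivity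
            · exact ih hl' (R + 1)
        _ = (1 / 2) ^ (R + 1) := by rw [pow_succ]; field_simp; ring

lemma precede_of_le_countP {θ : ℕ} {U : ι → Fin N} {val : ι → WithTop ℝ} {l : List ι}
    (hl : l.Pairwise fun a b => val a ≤ val b) {R : ℕ}
    (hR : R ≤ l.countP fun c => (θ ≤ (U c : ℕ) ∧ (U c : ℕ) < 2 * θ) ∧
      ∀ c' ∈ l, (U c' : ℕ) < θ → val c < val c') : Precede θ U l R := by
  induction l generalizing R with
  | nil =>
    cases R with
    | zero => trivial
    | succ R => simp at hR
  | cons c l ih =>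
    cases R with
    | zero => trivial
    | succ R =>
      obtain ⟨hc, hl'⟩ := List.pairwise_cons.1 hl
      have hmono : (l.countP fun b => (θ ≤ (U b : ℕ) ∧ (U b : ℕ) < 2 * θ) ∧
          ∀ c' ∈ c :: l, (U c' : ℕ) < θ → val b < val c') ≤
          l.countP fun b => (θ ≤ (U b : ℕ) ∧ (U b : ℕ) < 2 * θ) ∧
            ∀ c' ∈ l, (U c' : ℕ) < θ → val b < val c' := by
        refine List.countP_mono_left fun b _ hb => ?_
        rw [decide_eq_true_eq] at hb ⊢
        exact ⟨hb.1, fun c' hc' => hb.2 c' (List.mem_cons_of_mem _ hc')⟩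
      rw [List.countP_cons] at hR
      rcases Nat.lt_or_ge (U c : ℕ) θ with h1 | h1
      · exfalso
        have h2 : (l.countP fun b => (θ ≤ (U b : ℕ) ∧ (U b : ℕ) < 2 * θ) ∧
            ∀ c' ∈ c :: l, (U c' : ℕ) < θ → val b < val c') = 0 := by
          rw [List.countP_eq_zero]
          intro b hb hdec
          rw [decide_eq_true_eq] at hdec
          exact absurd (hdec.2 c (by simp) h1) (not_lt.2 (hc b hb))
        rw [h2, if_neg (by rw [decide_eq_true_eq]; omega)] at hR
        omega
      · rcases Nat.lt_or_ge (U c : ℕ) (2 * θ) with h2 | h2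
        · refine Or.inl ⟨by simp [h1, h2], ih hl' ?_⟩
          split_ifs at hR <;> omega
        · refine Or.inr ⟨by simp [h2], ih hl' ?_⟩
          rw [if_neg (by rw [decide_eq_true_eq]; omega)] at hR
          omega

/-- The random filter: with high probability, only few of the nodes of rank in `[θ, 2 θ)` have a
value less than those of all nodes of rank less than `θ`. -/
lemma prob_records_le {θ : ℕ} (hθ : 2 * θ ≤ N) (hN : 0 < N) (val : ι → WithTop ℝ) (R : ℕ) :
    prob (fun U : ι → Fin N => R ≤ (Finset.univ.filter fun c =>
      (θ ≤ (U c : ℕ) ∧ (U c : ℕ) < 2 * θ) ∧ ∀ c', (U c' : ℕ) < θ → val c < val c').card) ≤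
      (1 / 2 : ℝ) ^ R := by
  let l := (Finset.univ : Finset ι).toList.insertionSort fun a b => val a ≤ val b
  have hperm : l.Perm (Finset.univ : Finset ι).toList := List.perm_insertionSort _ _
  have hsort : l.Pairwise fun a b => val a ≤ val b := by
    have : Std.Total (fun a b : ι => val a ≤ val b) := ⟨fun a b => le_total _ _⟩
    have : IsTrans ι (fun a b : ι => val a ≤ val b) := ⟨fun a b c => le_trans⟩
    exact List.pairwise_insertionSort _ _
  refine (prob_mono fun U hU => ?_).trans
    (prob_precede_le hθ hN l (hperm.nodup_iff.2 (Finset.nodup_toList _)) R)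
  refine precede_of_le_countP hsort (val := val) (hU.trans (le_of_eq ?_))
  rw [hperm.countP_eq, List.countP_eq_length_filter]
  have hmem : ∀ c, c ∈ l := fun c => hperm.mem_iff.2 (by simp)
  simp only [hmem, forall_const]
  rw [← Multiset.coe_card, ← Multiset.filter_coe, Finset.coe_toList]
  rfl

end Prob

/-! ### Random choices are favourable with high probability -/

section Parameters

/-- The number of edges up to which level `i` runs the Bellman-Ford recursion. A node has rank less
than `2 ^ i / 2` with probability `2 ^ i / (2 * 2 ^ L)`, so that among this many nodes the expected
number of such nodes is `8 * L`, and there is none with probability at most `(2 ^ L)⁻⁸`. -/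
def hopBound (L i : ℕ) : ℕ := 2 * 2 ^ (L - i) * (8 * L)

/-- The number of rounds of a superstep. For `q = 8 * L`, a node forwards at most `n * q` tokens in a
phase, so that `m` of them meet in a superstep with probability at most `q ^ m / m !`, which is at
most `(1 / 2) ^ m` for `m = 8 * q ^ 2`. -/
def loadCap (L : ℕ) : ℕ := 8 * (8 * L) ^ 2

lemma le_loadCap (L : ℕ) : 8 * L ≤ loadCap L := by
  unfold loadCap
  nlinarith [Nat.zero_le L, sq_nonneg L, Nat.le_self_pow (n := 2) (by norm_num) (8 * L)]

lemma pow_le_factorial (q : ℕ) : (2 * q) ^ (8 * q ^ 2) ≤ (8 * q ^ 2).factorial := by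
  have h := Nat.factorial_mul_pow_le_factorial (m := 4 * q ^ 2) (n := 4 * q ^ 2)
  rw [show 4 * q ^ 2 + 4 * q ^ 2 = 8 * q ^ 2 by ring] at h
  calc (2 * q) ^ (8 * q ^ 2) = ((2 * q) ^ 2) ^ (4 * q ^ 2) := by rw [← pow_mul]; congr 1; ring
    _ ≤ (4 * q ^ 2 + 1) ^ (4 * q ^ 2) := Nat.pow_le_pow_left (by nlinarith) _
    _ ≤ (4 * q ^ 2).factorial * (4 * q ^ 2 + 1) ^ (4 * q ^ 2) :=
        Nat.le_mul_of_pos_left _ (Nat.factorial_pos _)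
    _ ≤ _ := h

lemma one_div_factorial_le (q : ℕ) : (1 : ℝ) / q.factorial ≤ 2 * (1 / 2) ^ q := by
  rcases q with _ | q
  · norm_num
  · have h := Nat.factorial_mul_pow_le_factorial (m := 1) (n := q)
    rw [Nat.factorial_one, one_mul, add_comm 1 q] at h
    have h' : (2 : ℝ) ^ q ≤ (q + 1).factorial := by exact_mod_cast h
    rw [pow_succ, one_div_pow, show (2 : ℝ) * (1 / 2 ^ q * (1 / 2)) = 1 / 2 ^ q by ring]
    exact one_div_le_one_div_of_le (by positivity) h'

end Parameters

section GoodProb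

variable {n : ℕ} {G : Network n} {L : ℕ}

/-- In some slot there are too many sources. -/
def SlotBad (L : ℕ) (U : Fin n → Fin (2 ^ L)) : Prop :=
  ∃ u : Fin (2 ^ L), 8 * L ≤ (Finset.univ.filter fun s => (U s : ℕ) + 0 = u).card

/-- The centers of small rank filter out too few tokens. -/
def FilterBad (G : Network n) (L : ℕ) (U : Fin n → Fin (2 ^ L)) : Prop :=
  ∃ a : Fin (L + 1) × Fin (L + 1) × Fin n × Fin n,
    8 * L ≤ (Finset.univ.filter fun c =>
      (2 ^ (a.2.1 : ℕ) / 2 ≤ (U c : ℕ) ∧ (U c : ℕ) < 2 * (2 ^ (a.2.1 : ℕ) / 2)) ∧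
      ∀ c', (U c' : ℕ) < 2 ^ (a.2.1 : ℕ) / 2 →
        bf G (hopBound L a.1) a.2.2.1 c + D G c a.2.2.2 <
          bf G (hopBound L a.1) a.2.2.1 c' + D G c' a.2.2.2).card

/-- The centers of a level miss the beginning of a shortest path with many edges. -/
def HitBad (G : Network n) (L : ℕ) (U : Fin n → Fin (2 ^ L)) : Prop :=
  ∃ a : Fin (L + 1) × Fin n × Fin n,
    bf G (hopBound L a.1) a.2.1 a.2.2 ≠ D G a.2.1 a.2.2 ∧
      ∀ c ∈ relays G (hopBound L a.1) a.2.1 a.2.2, ¬ (U c : ℕ) < 2 ^ (a.1 : ℕ) / 2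

/-- Too many tokens are to be forwarded at the same time. -/
def LoadBad (G : Network n) (L : ℕ) (U : Fin n → Fin (2 ^ L)) (X : Key n → Fin (2 ^ L)) : Prop :=
  ∃ a : Fin (L + 1) × Fin (L + 1) × Fin n × Fin (2 * 2 ^ L),
    (a.2.1 : ℕ) < a.1 ∧ loadCap L ≤ (load G (fun s => U s) (fun c s => X (s, c))
      (levelB G (fun s => U s) (hopBound L a.1) a.1) a.2.1 a.2.2.1 a.2.2.2).card

lemma good_of_not_bad (hn : n ≤ 2 ^ L)
    {U : Fin n → Fin (2 ^ L)} {X : Key n → Fin (2 ^ L)} (h1 : ¬ SlotBad L U)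
    (h3 : ¬ HitBad G L U) (h4 : ¬ LoadBad G L U X) :
    Good G (fun s => U s) (fun c s => X (s, c)) L (loadCap L) (2 * 2 ^ L) (hopBound L) := by
  refine ⟨fun s => (U s).2, fun c s => ?_, fun u => ?_, fun i hi s v hv => ?_,
    fun i hi j hj x t ht => ?_⟩
  · have := (X (s, c)).2
    omega
  · rcases Nat.lt_or_ge u (2 ^ L) with hu | hu
    · by_contra hc
      refine h1 ⟨⟨u, hu⟩, ?_⟩
      simp only [add_zero]
      have := le_loadCap L
      omega
    · rw [Finset.filter_false_of_mem]
      · simp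
      · intro s _
        have := (U s).2
        omega
  · by_contra hc
    push Not at hc
    exact h3 ⟨(⟨i, by omega⟩, s, v), hv, fun c hcr => not_lt.2 (hc c hcr)⟩
  · by_contra hc
    exact h4 ⟨(⟨i, by omega⟩, ⟨j, by omega⟩, x, ⟨t, ht⟩), hj, (not_le.1 hc).le⟩

lemma prob_slotBad_le (hn : n ≤ 2 ^ L) :
    prob (SlotBad (n := n) L) ≤ 2 ^ L * (2 * (1 / 2) ^ (8 * L)) := by
  have h : ∀ u : Fin (2 ^ L), prob (fun U : Fin n → Fin (2 ^ L) => 8 * L ≤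
      (Finset.univ.filter fun s => (U s : ℕ) + 0 = u).card) ≤ 2 * (1 / 2 : ℝ) ^ (8 * L) := by
    intro u
    refine (prob_many_le (N := 2 ^ L) Finset.univ (fun _ => 0) u (8 * L) (by positivity)).trans ?_
    refine le_trans ?_ (one_div_factorial_le (8 * L))
    rw [Finset.card_univ, Fintype.card_fin, div_le_div_iff₀ (by positivity) (by positivity),
      one_mul, mul_comm]
    gcongr
  refine (prob_exists_le h).trans ?_
  rw [Fintype.card_fin]
  push_cast
  exact le_rfl

lemma prob_filterBad_le : prob (FilterBad G L) ≤
    ((L + 1) * ((L + 1) * (n * n)) : ℝ) * (1 / 2) ^ (8 * L) := by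
  have h : ∀ a : Fin (L + 1) × Fin (L + 1) × Fin n × Fin n,
      prob (fun U : Fin n → Fin (2 ^ L) => 8 * L ≤ (Finset.univ.filter fun c =>
        (2 ^ (a.2.1 : ℕ) / 2 ≤ (U c : ℕ) ∧ (U c : ℕ) < 2 * (2 ^ (a.2.1 : ℕ) / 2)) ∧
        ∀ c', (U c' : ℕ) < 2 ^ (a.2.1 : ℕ) / 2 →
          bf G (hopBound L a.1) a.2.2.1 c + D G c a.2.2.2 <
            bf G (hopBound L a.1) a.2.2.1 c' + D G c' a.2.2.2).card) ≤
      (1 / 2 : ℝ) ^ (8 * L) := by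
    rintro ⟨i, j, s, x⟩
    dsimp only
    have hj : 2 * (2 ^ (j : ℕ) / 2) ≤ 2 ^ L :=
      (Nat.mul_div_le _ _).trans (Nat.pow_le_pow_right (by norm_num) (by omega))
    generalize 2 ^ (j : ℕ) / 2 = θ at hj ⊢
    have hN : 0 < 2 ^ L := by positivity
    generalize 2 ^ L = N at hj hN ⊢
    have := prob_records_le hj hN (fun c => bf G (hopBound L i) s c + D G c x) (8 * L)
    convert this
  refine (prob_exists_le h).trans ?_
  simp only [Fintype.card_prod, Fintype.card_fin]
  push_cast
  exact le_rfl

lemma prob_hitBad_le (hG : G.NoNegativeCycle) (hn : n ≤ 2 ^ L) (hL : 1 ≤ L) :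
    prob (HitBad G L) ≤ ((L + 1) * (n * n) : ℝ) * (1 / 2) ^ (8 * L) := by
  have hN : (0 : ℝ) < 2 ^ L := by positivity
  have h : ∀ a : Fin (L + 1) × Fin n × Fin n, prob (fun U : Fin n → Fin (2 ^ L) =>
      bf G (hopBound L a.1) a.2.1 a.2.2 ≠ D G a.2.1 a.2.2 ∧
      ∀ c ∈ relays G (hopBound L a.1) a.2.1 a.2.2, ¬ (U c : ℕ) < 2 ^ (a.1 : ℕ) / 2) ≤
      (1 / 2 : ℝ) ^ (8 * L) := by
    rintro ⟨⟨i, hi⟩, s, v⟩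
    dsimp only
    by_cases hv : bf G (hopBound L i) s v = D G s v
    · rw [prob_eq, Finset.filter_false_of_mem (by simp [hv])]
      simp
    rcases i with _ | i
    · -- In level `0` the recursion runs for at least `n` steps.
      refine absurd (bf_eq_D hG ?_ s v) hv
      unfold hopBound
      rw [Nat.sub_zero]
      nlinarith
    have hθ : 2 ^ (i + 1) / 2 = 2 ^ i := by rw [pow_succ]; omega
    have hiL : (2 : ℝ) ^ i ≤ 2 ^ L := pow_le_pow_right₀ (by norm_num) (by omega)
    have hcard := le_card_relays hG hv
    generalize relays G (hopBound L (i + 1)) s v = A at hcard ⊢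
    rw [hθ]
    have h1 := prob_forall_mem_le (N := 2 ^ L) A
      (fun _ => Finset.univ.filter fun w : Fin (2 ^ L) => ¬ (w : ℕ) < 2 ^ i)
      (q := 1 - 2 ^ i / 2 ^ L) (by
        intro a _
        have h2 : (Finset.univ.filter fun w : Fin (2 ^ L) => ¬ (w : ℕ) < 2 ^ i).card ≤
            (Finset.Ico (2 ^ i) (2 ^ L)).card :=
          Finset.card_le_card_of_injOn (fun w => (w : ℕ))
            (fun w hw => by simpa using hw) (fun w _ w' _ h => Fin.ext h)
        rw [Nat.card_Ico] at h2
        have h3 : ((2 ^ L - 2 ^ i : ℕ) : ℝ) = 2 ^ L - 2 ^ i := by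
          rw [Nat.cast_sub (by exact_mod_cast hiL)]; push_cast; ring
        push_cast
        rw [sub_mul, one_mul, div_mul_cancel₀ _ hN.ne', ← h3]
        exact_mod_cast h2) (by positivity)
    have hmono : prob (fun U : Fin n → Fin (2 ^ L) =>
        bf G (hopBound L (i + 1)) s v ≠ D G s v ∧ ∀ c ∈ A, ¬ (U c : ℕ) < 2 ^ i) ≤
        (1 - 2 ^ i / 2 ^ L : ℝ) ^ A.card := by
      refine le_trans (prob_mono fun U hU c hc => ?_) h1
      simpa using hU.2 c hc
    have hq0 : (0 : ℝ) ≤ 1 - 2 ^ i / 2 ^ L := by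
      rw [sub_nonneg, div_le_one hN]; exact hiL
    have hq1 : (1 : ℝ) - 2 ^ i / 2 ^ L ≤ 1 := by
      have : (0 : ℝ) ≤ 2 ^ i / 2 ^ L := by positivity
      linarith
    calc _ ≤ (1 - 2 ^ i / 2 ^ L : ℝ) ^ A.card := hmono
      _ ≤ (1 - 2 ^ i / 2 ^ L : ℝ) ^ hopBound L (i + 1) := pow_le_pow_of_le_one hq0 hq1 hcard
      _ ≤ (Real.exp (-(2 ^ i / 2 ^ L))) ^ hopBound L (i + 1) := by
          gcongr
          exact Real.one_sub_le_exp_neg _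
      _ = (Real.exp (-1)) ^ (8 * L) := by
          rw [← Real.exp_nat_mul, ← Real.exp_nat_mul]
          congr 1
          have hpow : (2 : ℝ) ^ L = 2 ^ (L - (i + 1)) * 2 ^ i * 2 := by
            rw [← pow_add, ← pow_succ]; congr 1; omega
          unfold hopBound
          rw [hpow]
          push_cast
          field_simp
      _ ≤ (1 / 2) ^ (8 * L) := by
          gcongr
          rw [Real.exp_neg, ← one_div]
          exact one_div_le_one_div_of_le (by norm_num) (by
            have := Real.add_one_le_exp (1 : ℝ); linarith)
  refine (prob_exists_le h).trans ?_
  simp only [Fintype.card_prod, Fintype.card_fin]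
  push_cast
  exact le_rfl

/-- The number of tokens that a node forwards in a phase. -/
lemma card_passing_le {U : Fin n → Fin (2 ^ L)} (h1 : ¬ SlotBad L U) (h2 : ¬ FilterBad G L U)
    {i j : ℕ} (hi : i ≤ L) (hj : j < i) (x : Fin n) :
    (Finset.univ.filter fun k : Key n => (2 ^ j / 2 ≤ (U k.2 : ℕ) ∧ (U k.2 : ℕ) < 2 ^ j) ∧
      Passes G (fun s => U s) (levelB G (fun s => U s) (hopBound L i) i) (2 ^ j / 2) k.1 k.2
        x).card ≤ n * (8 * L) := by
  rw [Finset.card_filter, Fintype.sum_prod_type]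
  simp only [← Finset.card_filter]
  refine (Finset.sum_le_card_nsmul Finset.univ _ (8 * L) fun s _ => ?_).trans (by simp)
  rcases j with _ | j
  · by_contra hc
    refine h1 ⟨⟨0, by positivity⟩, (not_le.1 hc).le.trans (Finset.card_le_card fun c hc => ?_)⟩
    simp only [Finset.mem_filter, Finset.mem_univ, true_and] at hc ⊢
    have := hc.1.2
    omega
  · have hpow : 2 * (2 ^ (j + 1) / 2) = 2 ^ (j + 1) := by rw [pow_succ]; omega
    by_contra hc
    refine h2 ⟨(⟨i, by omega⟩, ⟨j + 1, by omega⟩, s, x),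
      (not_le.1 hc).le.trans (Finset.card_le_card fun c hc => ?_)⟩
    simp only [Finset.mem_filter, Finset.mem_univ, true_and, hpow] at hc ⊢
    refine ⟨hc.1, fun c' hc' => ?_⟩
    have hp := hc.2.trans_le (through_le (c := c') hc')
    unfold levelB at hp
    split_ifs at hp with hs
    · exact hp
    · simp at hp

lemma prob_loadBad_le (hn : n ≤ 2 ^ L) {U : Fin n → Fin (2 ^ L)} (h1 : ¬ SlotBad L U)
    (h2 : ¬ FilterBad G L U) : prob (LoadBad G L U) ≤
      ((L + 1) * ((L + 1) * (n * (2 * 2 ^ L))) : ℝ) * (1 / 2) ^ (8 * L) := by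
  have h : ∀ a : Fin (L + 1) × Fin (L + 1) × Fin n × Fin (2 * 2 ^ L),
      prob (fun X : Key n → Fin (2 ^ L) =>
        (a.2.1 : ℕ) < a.1 ∧ loadCap L ≤ (load G (fun s => U s) (fun c s => X (s, c))
          (levelB G (fun s => U s) (hopBound L a.1) a.1) a.2.1 a.2.2.1 a.2.2.2).card) ≤
      (1 / 2 : ℝ) ^ (8 * L) := by
    rintro ⟨⟨i, hi⟩, ⟨j, hj⟩, x, t⟩
    dsimp only
    by_cases hji : j < i
    swap
    · rw [prob_eq, Finset.filter_false_of_mem (by simp [hji])]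
      simp
    have hF := card_passing_le h1 h2 (Nat.lt_succ_iff.1 hi) hji x
    generalize hFdef : (Finset.univ.filter fun k : Key n =>
      (2 ^ j / 2 ≤ (U k.2 : ℕ) ∧ (U k.2 : ℕ) < 2 ^ j) ∧ Passes G (fun s => U s)
        (levelB G (fun s => U s) (hopBound L i) i) (2 ^ j / 2) k.1 k.2 x) = F at hF
    refine (prob_mono fun X hX => hX.2.trans (Finset.card_le_card fun k hk => ?_)).trans
      ((prob_many_le (N := 2 ^ L) F (fun k => hops G (fun s => U s)
        (levelB G (fun s => U s) (hopBound L i) i) (2 ^ j / 2) k.1 k.2 x) t (loadCap L)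
        (by positivity)).trans ?_)
    · rw [← hFdef]
      simp only [load, Finset.mem_filter, Finset.mem_univ, true_and] at hk ⊢
      exact ⟨⟨hk.1, hk.2.1⟩, hk.2.2⟩
    · have hF' : (F.card : ℝ) ≤ 2 ^ L * (8 * L : ℕ) := by
        exact_mod_cast hF.trans (Nat.mul_le_mul_right _ hn)
      have hfac : ((2 * (8 * L) : ℕ) : ℝ) ^ loadCap L ≤ (loadCap L).factorial := by
        exact_mod_cast pow_le_factorial (8 * L)
      calc (F.card : ℝ) ^ loadCap L / ((loadCap L).factorial * ((2 ^ L : ℕ) : ℝ) ^ loadCap L)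
          ≤ (2 ^ L * (8 * L : ℕ)) ^ loadCap L /
              ((loadCap L).factorial * ((2 ^ L : ℕ) : ℝ) ^ loadCap L) := by gcongr
        _ = ((8 * L : ℕ) : ℝ) ^ loadCap L / (loadCap L).factorial := by
            push_cast
            rw [mul_pow, mul_comm ((loadCap L).factorial : ℝ),
              mul_div_mul_left _ _ (by positivity)]
        _ ≤ (1 / 2) ^ loadCap L := by
            rw [div_le_iff₀ (by positivity)]
            calc ((8 * L : ℕ) : ℝ) ^ loadCap L
                = (1 / 2) ^ loadCap L * ((2 * (8 * L) : ℕ) : ℝ) ^ loadCap L := by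
                  rw [← mul_pow]; congr 1; push_cast; ring
              _ ≤ _ := by gcongr
        _ ≤ (1 / 2) ^ (8 * L) := pow_le_pow_of_le_one (by norm_num) (by norm_num) (le_loadCap L)
  refine (prob_exists_le h).trans ?_
  simp only [Fintype.card_prod, Fintype.card_fin]
  push_cast
  exact le_rfl

/-- The random choices are favourable with high probability. -/
lemma prob_not_good_le (hG : G.NoNegativeCycle) (hn : n ≤ 2 ^ L) (hL : 1 ≤ L) :
    prob (fun w : (Fin n → Fin (2 ^ L)) × (Key n → Fin (2 ^ L)) =>
      ¬ Good G (fun s => w.1 s) (fun c s => w.2 (s, c)) L (loadCap L) (2 * 2 ^ L) (hopBound L)) ≤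
      1 / 2 ^ L := by
  have hsub : prob (fun w : (Fin n → Fin (2 ^ L)) × (Key n → Fin (2 ^ L)) =>
      ¬ Good G (fun s => w.1 s) (fun c s => w.2 (s, c)) L (loadCap L) (2 * 2 ^ L)
        (hopBound L)) ≤
      prob (fun w : (Fin n → Fin (2 ^ L)) × (Key n → Fin (2 ^ L)) =>
        (SlotBad L w.1 ∨ FilterBad G L w.1 ∨ HitBad G L w.1) ∨
        (¬ SlotBad L w.1 ∧ ¬ FilterBad G L w.1 ∧ LoadBad G L w.1 w.2)) := by
    refine prob_mono fun w hw => ?_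
    by_contra hc
    push Not at hc
    obtain ⟨⟨h1, h2, h3⟩, h4⟩ := hc
    exact hw (good_of_not_bad hn h1 h3 (h4 h1 h2))
  have hN2 : (2 : ℝ) ≤ 2 ^ L := by
    calc (2 : ℝ) = 2 ^ 1 := by norm_num
      _ ≤ 2 ^ L := pow_le_pow_right₀ (by norm_num) hL
  have hLN : (L : ℝ) + 1 ≤ 2 ^ L := by exact_mod_cast Nat.lt_two_pow_self
  have hnN : (n : ℝ) ≤ 2 ^ L := by exact_mod_cast hn
  have hε : (1 / 2 : ℝ) ^ (8 * L) = 1 / (2 ^ L) ^ 8 := by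
    rw [one_div_pow, ← pow_mul, mul_comm]
  have hload : prob (fun w : (Fin n → Fin (2 ^ L)) × (Key n → Fin (2 ^ L)) =>
      ¬ SlotBad L w.1 ∧ ¬ FilterBad G L w.1 ∧ LoadBad G L w.1 w.2) ≤
      ((L + 1) * ((L + 1) * (n * (2 * 2 ^ L))) : ℝ) * (1 / 2) ^ (8 * L) := by
    refine prob_prod_le (p := fun U X => ¬ SlotBad L U ∧ ¬ FilterBad G L U ∧ LoadBad G L U X)
      (by positivity) fun U => ?_
    by_cases h : ¬ SlotBad L U ∧ ¬ FilterBad G L U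
    · exact (prob_mono fun X hX => hX.2.2).trans (prob_loadBad_le hn h.1 h.2)
    · rw [prob_eq, Finset.filter_false_of_mem fun X _ hX => h ⟨hX.1, hX.2.1⟩]
      simp only [Finset.card_empty, Nat.cast_zero, zero_div]
      positivity
  have hfirst : prob (fun w : (Fin n → Fin (2 ^ L)) × (Key n → Fin (2 ^ L)) =>
      SlotBad L w.1 ∨ FilterBad G L w.1 ∨ HitBad G L w.1) ≤
      2 ^ L * (2 * (1 / 2) ^ (8 * L)) + (((L + 1) * ((L + 1) * (n * n)) : ℝ) * (1 / 2) ^ (8 * L) +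
        ((L + 1) * (n * n) : ℝ) * (1 / 2) ^ (8 * L)) :=
    (prob_fst_le fun U => SlotBad L U ∨ FilterBad G L U ∨ HitBad G L U).trans
      ((prob_or_le _ _).trans (add_le_add (prob_slotBad_le hn) ((prob_or_le _ _).trans
        (add_le_add prob_filterBad_le (prob_hitBad_le hG hn hL)))))
  refine hsub.trans ((prob_or_le _ _).trans ((add_le_add hfirst hload).trans ?_))
  rw [hε]
  generalize (2 : ℝ) ^ L = N at *
  have hN0 : (0 : ℝ) < N := by linarith
  calc _ ≤ N * (2 * (1 / N ^ 8)) + (N * (N * (N * N)) * (1 / N ^ 8) +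
        N * (N * N) * (1 / N ^ 8)) + N * (N * (N * (2 * N))) * (1 / N ^ 8) := by gcongr
    _ = (2 * N + N ^ 3 + 3 * N ^ 4) / N ^ 8 := by ring
    _ ≤ N ^ 7 / N ^ 8 := by
        gcongr
        have h2 : 2 * 2 ≤ N ^ 2 := by nlinarith
        have h3 : 2 * 2 * 2 ≤ N ^ 3 := by nlinarith
        have h4 : N ^ 3 ≤ N ^ 4 := by nlinarith [pow_pos hN0 3]
        have h5 : 2 * N ≤ N ^ 4 := by nlinarith [pow_pos hN0 3]
        nlinarith [pow_pos hN0 4]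
    _ = 1 / N := by field_simp

end GoodProb

/-! ### The attempt -/

section TheAttempt

lemma one_le_clog {n : ℕ} (hn : 2 ≤ n) : 1 ≤ Nat.clog 2 n := Nat.clog_pos (by norm_num) hn

lemma le_pow_clog (n : ℕ) : n ≤ 2 ^ Nat.clog 2 n := Nat.le_pow_clog (by norm_num) n

lemma pow_clog_le {n : ℕ} (hn : 2 ≤ n) : 2 ^ Nat.clog 2 n ≤ 2 * n := by
  have h := Nat.pow_pred_clog_lt_self (b := 2) (by norm_num) hn
  obtain ⟨m, hm⟩ := Nat.exists_eq_succ_of_ne_zero (Nat.one_le_iff_ne_zero.1 (one_le_clog hn))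
  rw [hm] at h ⊢
  rw [pow_succ]
  have : 2 ^ m < n := h
  omega

/-- The coins of a node amount to a rank and a delay for each source. -/
def decode (n L : ℕ) : (Fin (L * (n + 1)) → Bool) ≃ Fin (2 ^ L) × (Fin n → Fin (2 ^ L)) :=
  Fintype.equivOfCardEq (by
    simp only [Fintype.card_fun, Fintype.card_bool, Fintype.card_fin, Fintype.card_prod]
    rw [← pow_mul, ← pow_add]
    congr 1
    ring)

/-- The coins of all nodes amount to ranks and delays. -/
def decodeAll (n L : ℕ) : (Fin n → Fin (L * (n + 1)) → Bool) ≃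
    (Fin n → Fin (2 ^ L)) × (Key n → Fin (2 ^ L)) where
  toFun ξ := (fun v => (decode n L (ξ v)).1, fun k => (decode n L (ξ k.2)).2 k.1)
  invFun w := fun v => (decode n L).symm (w.1 v, fun s => w.2 (s, v))
  left_inv ξ := by
    funext v
    simp
  right_inv w := by simp

/-- An attempt to compute all distances, with messages of `10 * ⌈log₂ n⌉` bits. -/
def apspAttempt (n : ℕ) (hn : 2 ≤ n) : Attempt n (10 * Nat.clog 2 n) where
  Λ := Loc n
  S := Mem n
  numCoins := Nat.clog 2 n * (n + 1)
  loc I ξ := ⟨I, (decode n (Nat.clog 2 n) ξ).1, fun s => (decode n (Nat.clog 2 n) ξ).2 s⟩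
  start := Mem.start n
  prog := fullProgram n (Nat.clog 2 n) (2 * 2 ^ Nat.clog 2 n) (hopBound (Nat.clog 2 n))
  result _ m := resultOf m
  cap := loadCap (Nat.clog 2 n)
  cap_pos := by
    have := le_loadCap (Nat.clog 2 n)
    have := one_le_clog hn
    omega
  code k := BitVec.ofNat _ (finProdFinEquiv k)
  code_injective := by
    intro k k' h
    have hlt : ∀ k : Key n, (finProdFinEquiv k : ℕ) < 2 ^ (10 * Nat.clog 2 n) := fun k => by
      have h1 := (finProdFinEquiv k).2
      have h2 := le_pow_clog n
      calc (finProdFinEquiv k : ℕ) < n * n := h1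
        _ ≤ 2 ^ Nat.clog 2 n * 2 ^ Nat.clog 2 n := Nat.mul_le_mul h2 h2
        _ = 2 ^ (2 * Nat.clog 2 n) := by rw [← pow_add]; congr 1; ring
        _ ≤ _ := Nat.pow_le_pow_right (by norm_num) (by omega)
    have h' := congrArg BitVec.toNat h
    rw [BitVec.toNat_ofNat, BitVec.toNat_ofNat, Nat.mod_eq_of_lt (hlt k),
      Nat.mod_eq_of_lt (hlt k')] at h'
    exact finProdFinEquiv.injective (Fin.ext h')

/-- The fixed data of the nodes in an attempt with the coins `ξ`. -/
def apspLoc {n : ℕ} (G : Network n) (ξ : Fin n → Fin (Nat.clog 2 n * (n + 1)) → Bool) :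
    Fin n → Loc n := fun x =>
  ⟨G.localInput x, (decode n (Nat.clog 2 n) (ξ x)).1, fun s => (decode n (Nat.clog 2 n) (ξ x)).2 s⟩

lemma fits_apspLoc {n : ℕ} {G : Network n} (ξ : Fin n → Fin (Nat.clog 2 n * (n + 1)) → Bool) :
    Fits G (apspLoc G ξ) := fun _ => rfl

lemma hopBound_le (L i : ℕ) : hopBound L i ≤ hopBound L 0 := by
  unfold hopBound
  gcongr
  · norm_num
  · omega

variable {n : ℕ} (hn : 2 ≤ n) {G : Network n}
include hn

lemma sum_hopBound_le : (Nat.clog 2 n + 1) * hopBound (Nat.clog 2 n) 0 ≤ n ^ 10 := by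
  have h1 := pow_clog_le hn
  have h2 : Nat.clog 2 n < 2 ^ Nat.clog 2 n := Nat.lt_two_pow_self
  unfold hopBound
  rw [Nat.sub_zero]
  generalize Nat.clog 2 n = L at *
  calc (L + 1) * (2 * 2 ^ L * (8 * L)) ≤ (2 * n) * (2 * (2 * n) * (8 * (2 * n))) := by
        gcongr <;> omega
    _ = 2 ^ 7 * n ^ 3 := by ring
    _ ≤ n ^ 7 * n ^ 3 := by gcongr
    _ = n ^ 10 := by ring

/-- All real numbers that are sent are lengths of walks. -/
lemma apspAttempt_sends : (apspAttempt n hn).program.SendsOnlyPathLengths G (n ^ 10) := by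
  refine Attempt.sendsOnlyPathLengths _ G _ fun ξ l₁ p l₂ hl x k r hr => ?_
  have h := (triple_fullProgram (Q := (apspAttempt n hn).cap) (fits_apspLoc (G := G) ξ)
    (H := hopBound (Nat.clog 2 n) 0) (hopBound_le (Nat.clog 2 n)) (sum_hopBound_le hn)
    (τ := 2 * 2 ^ Nat.clog 2 n) _ (Sound.start _)).1
  rw [show fullProgram n (Nat.clog 2 n) _ _ = l₁ ++ p :: l₂ from hl] at h
  obtain ⟨a, b, hab⟩ := h.out x k
  obtain ⟨m, hm, hw⟩ := hab r hr
  exact ⟨a, b, m, hm, hw⟩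

lemma outcome_eq (ξ : Fin n → Fin (Nat.clog 2 n * (n + 1)) → Bool) (x : Fin n) :
    (apspAttempt n hn).outcome G ξ x = resultOf (exec G (loadCap (Nat.clog 2 n))
      (apspLoc G ξ) (verify n) (exec G (loadCap (Nat.clog 2 n)) (apspLoc G ξ)
        ((List.range (Nat.clog 2 n + 1)).flatMap fun i =>
          level (hopBound (Nat.clog 2 n) i) (2 * 2 ^ Nat.clog 2 n) i) fun _ => Mem.start n) x) :=
  calc (apspAttempt n hn).outcome G ξ x = resultOf (exec G (loadCap (Nat.clog 2 n)) (apspLoc G ξ)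
        (fullProgram n (Nat.clog 2 n) (2 * 2 ^ Nat.clog 2 n) (hopBound (Nat.clog 2 n)))
        (fun _ => Mem.start n) x) := rfl
    _ = _ := by rw [fullProgram, exec_append]

lemma one_le_cap : 1 ≤ loadCap (Nat.clog 2 n) := (apspAttempt n hn).cap_pos

lemma apspAttempt_correct (hG : G.NoNegativeCycle) :
    (apspAttempt n hn).program.AlwaysCorrect G := by
  refine Attempt.alwaysCorrect _ G fun ξ x d hd u => ?_
  replace hd := (outcome_eq hn ξ x).symm.trans hd
  exact result_correct (fits_apspLoc ξ) (one_le_cap hn) hG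
    (triple_levels (fits_apspLoc (G := G) ξ) (hopBound_le (Nat.clog 2 n)) le_rfl _
      (Sound.start _)).2 hd u

lemma apspAttempt_simultaneous (hG : G.NoNegativeCycle) (hs : G.StronglyConnected) :
    (apspAttempt n hn).program.StopsSimultaneously G := by
  refine Attempt.stopsSimultaneously _ G fun ξ x y h => ?_
  have h' := result_simultaneous (fits_apspLoc ξ) (one_le_cap hn) hG hs _ x y
    ((congrArg _ (outcome_eq hn ξ x)).symm.trans h)
  exact (congrArg _ (outcome_eq hn ξ y)).trans h'

/-- The probability that an attempt fails. -/
lemma prob_fail_le (hG : G.NoNegativeCycle) :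
    prob (fun ξ => ∃ x, ¬ ((apspAttempt n hn).outcome G ξ x).isSome) ≤ 1 / n := by
  have h1 : prob (fun ξ => ∃ x, ¬ ((apspAttempt n hn).outcome G ξ x).isSome) ≤ 1 / 2 ^ Nat.clog 2 n := by
    refine le_trans ?_ (prob_not_good_le hG (le_pow_clog n) (one_le_clog hn))
    rw [← prob_equiv (decodeAll n (Nat.clog 2 n))]
    refine prob_mono (α := Fin n → Fin (Nat.clog 2 n * (n + 1)) → Bool) fun ξ hξ hgood => ?_
    obtain ⟨x, hx⟩ := hξ
    refine hx ?_
    refine (congrArg _ (outcome_eq hn ξ x)).trans ?_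
    exact result_isSome (fits_apspLoc ξ) (one_le_cap hn) hG
      (fun x s => exec_levels hG (fits_apspLoc ξ) hgood _ x s) x
  refine h1.trans (one_div_le_one_div_of_le (by positivity) ?_)
  exact_mod_cast le_pow_clog n

/-! ### The number of rounds of an attempt -/

omit hn in
lemma length_flatMap_range_le {α : Type*} (f : ℕ → List α) (m b : ℕ)
    (h : ∀ i < m, (f i).length ≤ b) : ((List.range m).flatMap f).length ≤ m * b := by
  induction m with
  | zero => simp
  | succ m ih =>
    rw [List.range_succ, List.flatMap_append, List.length_append, add_mul, one_mul]
    refine Nat.add_le_add (ih fun i hi => h i (by omega)) ?_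
    simpa using h m (by omega)

omit hn in
lemma length_level_le {L i : ℕ} (hL : 1 ≤ L) (hi : i ≤ L) :
    (level (n := n) (hopBound L i) (2 * 2 ^ L) i).length ≤ 24 * L * 2 ^ L := by
  have h1 := length_flatMap_range_le (slot (n := n) (hopBound L i)) (2 ^ i) (hopBound L i + 2)
    (fun u _ => by simp [slot])
  have h2 := length_flatMap_range_le (phase (n := n) (2 * 2 ^ L)) i (2 * 2 ^ L + 2)
    (fun u _ => by simp [phase])
  have hpow : 2 ^ i * 2 ^ (L - i) = 2 ^ L := by rw [← pow_add]; congr 1; omega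
  have h3 : 2 ^ i * (hopBound L i + 2) ≤ 18 * L * 2 ^ L := by
    have : 2 ^ i ≤ L * 2 ^ L :=
      (Nat.pow_le_pow_right (by norm_num) hi).trans (Nat.le_mul_of_pos_left _ hL)
    calc 2 ^ i * (hopBound L i + 2) = 16 * L * (2 ^ i * 2 ^ (L - i)) + 2 * 2 ^ i := by
          unfold hopBound; ring
      _ ≤ 16 * L * 2 ^ L + 2 * L * 2 ^ L := by rw [hpow]; nlinarith
      _ = _ := by ring
  have hN : 2 ≤ 2 ^ L := by
    calc 2 = 2 ^ 1 := rfl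
      _ ≤ 2 ^ L := Nat.pow_le_pow_right (by norm_num) hL
  have h4 : i * (2 * 2 ^ L + 2) ≤ 4 * L * 2 ^ L := by
    calc i * (2 * 2 ^ L + 2) ≤ L * (4 * 2 ^ L) := Nat.mul_le_mul hi (by omega)
      _ = _ := by ring
  simp only [level, List.length_cons, List.length_append, List.length_nil]
  nlinarith

lemma period_le : (apspAttempt n hn).period ≤ 60000 * n * Nat.clog 2 n ^ 4 := by
  have hL := one_le_clog hn
  have hN := pow_clog_le hn
  have hlen : (apspAttempt n hn).prog.length ≤ 52 * Nat.clog 2 n ^ 2 * 2 ^ Nat.clog 2 n := by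
    have h1 := length_flatMap_range_le (fun i => level (n := n) (hopBound (Nat.clog 2 n) i)
      (2 * 2 ^ Nat.clog 2 n) i) (Nat.clog 2 n + 1) _
      fun i hi => length_level_le hL (Nat.lt_succ_iff.1 hi)
    have h2 := le_pow_clog n
    change (fullProgram n _ _ _).length ≤ _
    simp only [fullProgram, verify, List.length_append, List.length_cons, List.length_map,
      List.length_finRange, List.length_replicate]
    generalize Nat.clog 2 n = L at *
    have h3 : (L + 1) * (24 * L * 2 ^ L) ≤ 48 * L ^ 2 * 2 ^ L := by
      calc (L + 1) * (24 * L * 2 ^ L) ≤ (2 * L) * (24 * L * 2 ^ L) := by gcongr; omega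
        _ = _ := by ring
    have h4 : 2 ^ L ≤ L ^ 2 * 2 ^ L := Nat.le_mul_of_pos_left _ (by positivity)
    nlinarith
  have hcap : (apspAttempt n hn).cap = loadCap (Nat.clog 2 n) := rfl
  unfold Attempt.period
  rw [hcap]
  unfold loadCap
  clear hcap
  generalize (apspAttempt n hn).prog.length = ℓ at *
  generalize Nat.clog 2 n = L at *
  calc 8 * (8 * L) ^ 2 * ℓ + 2
      ≤ 8 * (8 * L) ^ 2 * (52 * L ^ 2 * (2 * n)) + 2 := by
        gcongr
        exact hlen.trans (Nat.mul_le_mul_left _ hN)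
    _ = 53248 * (n * L ^ 4) + 2 := by ring
    _ ≤ 60000 * n * L ^ 4 := by
        have : 1 ≤ n * L ^ 4 := Nat.mul_pos (by omega) (by positivity)
        nlinarith

lemma clog_le : (Nat.clog 2 n : ℝ) ≤ 3 * Real.log (n + 1) := by
  have hN := pow_clog_le hn
  have h1 : (Nat.clog 2 n : ℝ) * Real.log 2 ≤ Real.log 2 + Real.log n := by
    rw [← Real.log_pow, ← Real.log_mul (by norm_num) (by positivity)]
    exact Real.log_le_log (by positivity) (by exact_mod_cast hN)
  have h2 : Real.log n ≤ Real.log (n + 1) :=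
    Real.log_le_log (by positivity) (by linarith)
  have h3 : 1 ≤ Real.log (n + 1) := by
    rw [Real.le_log_iff_exp_le (by positivity)]
    have : (2 : ℝ) ≤ n := by exact_mod_cast hn
    have := Real.exp_one_lt_d9
    linarith
  have h4 := Real.log_two_gt_d9
  have h5 := Real.log_two_lt_d9
  nlinarith

lemma period_le_log :
    ((apspAttempt n hn).period : ℝ) ≤ 4860000 * n * Real.log (n + 1) ^ 4 := by
  have h1 : ((apspAttempt n hn).period : ℝ) ≤ 60000 * n * (Nat.clog 2 n : ℝ) ^ 4 := by
    exact_mod_cast period_le hn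
  refine h1.trans ?_
  calc 60000 * (n : ℝ) * (Nat.clog 2 n : ℝ) ^ 4
      ≤ 60000 * n * (3 * Real.log (n + 1)) ^ 4 := by gcongr; exact clog_le hn
    _ = _ := by ring

end TheAttempt

/-! ### Repeated attempts -/

section Repetition

lemma uniform_bool_singleton (b : Bool) :
    (PMF.uniformOfFintype Bool).toMeasure {b} = 2⁻¹ := by
  rw [PMF.toMeasure_apply_singleton _ _ (measurableSet_singleton b), PMF.uniformOfFintype_apply]
  simp

variable {n L : ℕ} (A : Attempt n L) (G : Network n)

instance (n : ℕ) : IsProbabilityMeasure (coinMeasure n) := by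
  unfold coinMeasure
  infer_instance

/-- The coins of different attempts are independent and uniformly distributed. -/
lemma coinMeasure_forall_le (p : (Fin n → Fin A.numCoins → Bool) → Prop) (a : ℕ) :
    coinMeasure n {ω | ∀ b < a, p (A.coinsAt ω (b * A.period))} ≤
      ((Nat.card {ξ // p ξ} : ℝ≥0∞) * 2⁻¹ ^ (n * A.numCoins)) ^ a := by
  let φ : Fin a × Fin n × Fin A.numCoins → ℕ × Fin n × ℕ := fun q => (q.1 * A.period, q.2.1, q.2.2)
  have hφ : Function.Injective φ := by
    rintro ⟨b, v, i⟩ ⟨b', v', i'⟩ h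
    simp only [φ, Prod.mk.injEq] at h
    have hP : 0 < A.period := by unfold Attempt.period; omega
    exact Prod.ext (Fin.ext (Nat.eq_of_mul_eq_mul_right hP h.1))
      (Prod.ext h.2.1 (Fin.ext h.2.2))
  let g : (Fin a → {ξ // p ξ}) → Coins n := fun f =>
    Function.extend φ (fun q => (f q.1).1 q.2.1 q.2.2) fun _ => false
  have hcover : {ω | ∀ b < a, p (A.coinsAt ω (b * A.period))} ⊆
      ⋃ f : Fin a → {ξ // p ξ},
        Set.pi (Finset.univ.image φ : Finset _) fun q => {g f q} := by
    intro ω hω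
    refine Set.mem_iUnion.2 ⟨fun b => ⟨A.coinsAt ω (b * A.period), hω b b.2⟩, ?_⟩
    intro q hq
    obtain ⟨q, -, rfl⟩ := Finset.mem_image.1 (Finset.mem_coe.1 hq)
    simp only [g, hφ.extend_apply]
    rfl
  have hcyl : ∀ f : Fin a → {ξ // p ξ}, coinMeasure n
      (Set.pi (Finset.univ.image φ : Finset _) fun q => {g f q}) =
      (2⁻¹ ^ (n * A.numCoins)) ^ a := by
    intro f
    unfold coinMeasure
    rw [Measure.infinitePi_pi _ fun q _ => measurableSet_singleton _]
    simp only [uniform_bool_singleton]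
    rw [Finset.prod_const, Finset.card_image_of_injective _ hφ, Finset.card_univ]
    simp only [Fintype.card_prod, Fintype.card_fin]
    rw [← pow_mul, mul_comm a]
  refine (measure_mono hcover).trans ((measure_iUnion_le _).trans (le_of_eq ?_))
  simp only [hcyl]
  rw [tsum_fintype, Finset.sum_const, Finset.card_univ, Fintype.card_fun, Fintype.card_fin,
    nsmul_eq_mul, mul_pow, Nat.card_eq_fintype_card]
  push_cast
  rfl

/-- Some node has no result after the attempt with the coins `ξ`. -/
def Attempt.Fails (ξ : Fin n → Fin A.numCoins → Bool) : Prop := ∃ x, ¬ (A.outcome G ξ x).isSome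

lemma coinMeasure_fails_le (hp : prob (A.Fails G) ≤ 1 / n) (hn : 0 < n) (a : ℕ) :
    coinMeasure n {ω | ∀ b < a, A.Fails G (A.coinsAt ω (b * A.period))} ≤
      ((n : ℝ≥0∞) ^ a)⁻¹ := by
  refine (coinMeasure_forall_le A (A.Fails G) a).trans ?_
  rw [ENNReal.inv_pow]
  gcongr
  have hcard : Nat.card {ξ // A.Fails G ξ} * n ≤ 2 ^ (n * A.numCoins) := by
    rw [prob, div_le_div_iff₀ (by exact_mod_cast Nat.card_pos) (by exact_mod_cast hn),
      one_mul] at hp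
    have h2 : Nat.card (Fin n → Fin A.numCoins → Bool) = 2 ^ (n * A.numCoins) := by
      simp only [Nat.card_eq_fintype_card, Fintype.card_fun, Fintype.card_fin, Fintype.card_bool]
      rw [← pow_mul, mul_comm]
    rw [← h2]
    exact_mod_cast hp
  rw [ENNReal.le_inv_iff_mul_le, mul_right_comm, ← ENNReal.inv_pow]
  calc (Nat.card {ξ // A.Fails G ξ} : ℝ≥0∞) * n * (2 ^ (n * A.numCoins))⁻¹
      ≤ 2 ^ (n * A.numCoins) * (2 ^ (n * A.numCoins))⁻¹ := by
        gcongr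
        exact_mod_cast hcard
    _ ≤ 1 := ENNReal.mul_inv_le_one _

lemma rounds_le (ω : Coins n) (b : ℕ) (h : ¬ A.Fails G (A.coinsAt ω (b * A.period))) :
    A.program.rounds G ω ≤ ((b + 1) * A.period : ℕ) := by
  unfold Attempt.Fails at h
  push Not at h
  exact iInf₂_le ((b + 1) * A.period) fun x => A.isSome_outputAt G ω b h x

lemma coinMeasure_lt_rounds_le (hp : prob (A.Fails G) ≤ 1 / n) (hn : 0 < n) (a : ℕ) {C : ℝ}
    (hC : a * (A.period : ℝ) ≤ C) :
    coinMeasure n {ω | ENNReal.ofReal C < (A.program.rounds G ω : ℝ≥0∞)} ≤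
      ((n : ℝ≥0∞) ^ a)⁻¹ := by
  refine (measure_mono fun ω hω b hb => ?_).trans (coinMeasure_fails_le A G hp hn a)
  by_contra hf
  have hω' : ENNReal.ofReal C < (A.program.rounds G ω : ℝ≥0∞) := hω
  refine absurd hω' (not_lt.2 ?_)
  have h1 := rounds_le A G ω b hf
  have h2 : (A.program.rounds G ω : ℝ≥0∞) ≤ (((b + 1) * A.period : ℕ) : ℝ≥0∞) := by
    have := ENat.toENNReal_le.2 h1
    simpa using this
  refine h2.trans ?_
  rw [← ENNReal.ofReal_natCast]
  refine ENNReal.ofReal_le_ofReal (le_trans ?_ hC)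
  exact_mod_cast Nat.mul_le_mul_right _ hb

lemma measurableSet_fails (a : ℕ) :
    MeasurableSet {ω : Coins n | ∀ b < a, A.Fails G (A.coinsAt ω (b * A.period))} := by
  have hm : ∀ t, Measurable fun ω : Coins n => A.coinsAt ω t := fun t =>
    measurable_pi_iff.2 fun v => measurable_pi_iff.2 fun i => measurable_pi_apply _
  have : {ω : Coins n | ∀ b < a, A.Fails G (A.coinsAt ω (b * A.period))} =
      ⋂ b : ℕ, ⋂ _ : b < a, (fun ω => A.coinsAt ω (b * A.period)) ⁻¹' {ξ | A.Fails G ξ} := by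
    ext ω; simp
  rw [this]
  exact MeasurableSet.iInter fun b => MeasurableSet.iInter fun _ =>
    hm _ (Set.toFinite _).measurableSet

/-- An attempt is made only if all attempts before it have failed, so that the expected number of
attempts is at most a geometric series. -/
lemma lintegral_rounds_le (hp : prob (A.Fails G) ≤ 1 / n) (hn : 2 ≤ n) :
    ∫⁻ ω, (A.program.rounds G ω : ℝ≥0∞) ∂(coinMeasure n) ≤ A.period * 2 := by
  let F : ℕ → Set (Coins n) := fun a => {ω | ∀ b < a, A.Fails G (A.coinsAt ω (b * A.period))}
  have hpt : ∀ ω, (A.program.rounds G ω : ℝ≥0∞) ≤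
      ∑' a, (F a).indicator (fun _ => (A.period : ℝ≥0∞)) ω := by
    intro ω
    by_cases h : ∃ b, ¬ A.Fails G (A.coinsAt ω (b * A.period))
    · have h1 := rounds_le A G ω (Nat.find h) (Nat.find_spec h)
      have h2 : ∀ a ∈ Finset.range (Nat.find h + 1), (F a).indicator
          (fun _ => (A.period : ℝ≥0∞)) ω = A.period := by
        intro a ha
        refine Set.indicator_of_mem (fun b hb => ?_) _
        rw [Finset.mem_range] at ha
        exact not_not.1 (Nat.find_min h (by omega))
      refine le_trans ?_ (ENNReal.sum_le_tsum (Finset.range (Nat.find h + 1)))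
      rw [Finset.sum_congr rfl h2, Finset.sum_const, Finset.card_range, nsmul_eq_mul]
      have := ENat.toENNReal_le.2 h1
      push_cast at this ⊢
      simpa using this
    · push Not at h
      have h2 : ∀ a, (F a).indicator (fun _ => (A.period : ℝ≥0∞)) ω = A.period :=
        fun a => Set.indicator_of_mem (show ω ∈ F a from fun b _ => h b) _
      simp only [h2]
      rw [ENNReal.tsum_const_eq_top_of_ne_zero]
      · exact le_top
      · unfold Attempt.period
        simp
  refine (lintegral_mono hpt).trans ?_
  rw [lintegral_tsum fun a => (measurable_const.indicator (measurableSet_fails A G a)).aemeasurable]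
  have hterm : ∀ a, ∫⁻ ω, (F a).indicator (fun _ => (A.period : ℝ≥0∞)) ω ∂(coinMeasure n) ≤
      A.period * 2⁻¹ ^ a := by
    intro a
    rw [lintegral_indicator_const (measurableSet_fails A G a)]
    gcongr
    refine (coinMeasure_fails_le A G hp (by omega) a).trans ?_
    rw [← ENNReal.inv_pow]
    gcongr
    exact_mod_cast hn
  refine (ENNReal.tsum_le_tsum hterm).trans (le_of_eq ?_)
  rw [ENNReal.tsum_mul_left, ENNReal.tsum_geometric, ENNReal.one_sub_inv_two, inv_inv]

end Repetition

/-! ### Networks with at most one node -/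

/-- On at most one node, the only distance is zero, and it is announced without any round. -/
def trivialProgram (n L : ℕ) : NodeProgram n L where
  State := Unit
  numCoins := 0
  init _ := ()
  send _ := none
  step _ _ _ := ()
  output _ := some fun _ => 0
  output_final _ _ _ _ h := h

lemma trivialProgram_correct {n L : ℕ} (hn : ¬ 2 ≤ n) {G : Network n} (hG : G.NoNegativeCycle) :
    (trivialProgram n L).AlwaysCorrect G := by
  intro ω t v d hd u
  obtain rfl : (fun _ => 0) = d := Option.some.inj hd
  obtain rfl : u = v := Fin.ext (by omega)
  rw [← dist_eq_D hG, D_self hG]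
  rfl

lemma trivialProgram_rounds {n L : ℕ} (G : Network n) (ω : Coins n) :
    (trivialProgram n L).rounds G ω = 0 :=
  nonpos_iff_eq_zero.1 (iInf₂_le (0 : ℕ) fun _ => rfl)

/-- The program for networks with `n` nodes. -/
def apspProgram (n : ℕ) : NodeProgram n (10 * Nat.clog 2 n) :=
  if hn : 2 ≤ n then (apspAttempt n hn).program else trivialProgram n _

end APSP

open APSP in
theorem mainTheorem1 :
    ∃ (c k : ℕ) (A : ∀ n : ℕ, NodeProgram n (c * Nat.clog 2 n)),
      (∀ (n : ℕ) (G : Network n), G.NoNegativeCycle →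
        (A n).SendsOnlyPathLengths G (n ^ c) ∧
        (A n).AlwaysCorrect G ∧
        (G.StronglyConnected → (A n).StopsSimultaneously G)) ∧
      (∃ C : ℝ, ∀ (n : ℕ) (G : Network n), G.NoNegativeCycle →
        ∫⁻ ω, ((A n).rounds G ω : ℝ≥0∞) ∂(coinMeasure n) ≤
          ENNReal.ofReal (C * n * Real.log (n + 1) ^ k)) ∧
      (∀ a : ℕ, ∃ C : ℝ, ∀ (n : ℕ) (G : Network n), G.NoNegativeCycle →
        coinMeasure n {ω | ENNReal.ofReal (C * n * Real.log (n + 1) ^ k) < ((A n).rounds G ω : ℝ≥0∞)} ≤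
          ((n : ℝ≥0∞) ^ a)⁻¹) := by
  refine ⟨10, 4, apspProgram, fun n G hG => ?_, ⟨4860000 * 2, fun n G hG => ?_⟩,
    fun a => ⟨a * 4860000, fun n G hG => ?_⟩⟩
  · unfold apspProgram
    split_ifs with hn
    · exact ⟨apspAttempt_sends hn, apspAttempt_correct hn hG, apspAttempt_simultaneous hn hG⟩
    · refine ⟨fun ω t v msg x h => ?_, trivialProgram_correct hn hG, fun _ ω t v v' h => h⟩
      simp [trivialProgram] at h
  · unfold apspProgram
    split_ifs with hn
    · refine (lintegral_rounds_le _ G (prob_fail_le hn hG) hn).trans ?_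
      have h := ENNReal.ofReal_le_ofReal (mul_le_mul_of_nonneg_right (period_le_log hn)
        (by norm_num : (0 : ℝ) ≤ 2))
      rw [ENNReal.ofReal_mul (by positivity), ENNReal.ofReal_natCast, ENNReal.ofReal_ofNat] at h
      refine h.trans (le_of_eq ?_)
      congr 1
      ring
    · simp [trivialProgram_rounds]
  · unfold apspProgram
    split_ifs with hn
    · refine coinMeasure_lt_rounds_le _ G (prob_fail_le hn hG) (by omega) a ?_
      calc (a : ℝ) * (apspAttempt n hn).period
          ≤ a * (4860000 * n * Real.log (n + 1) ^ 4) := by gcongr; exact period_le_log hn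
        _ = _ := by ring
    · simp [trivialProgram_rounds]

end
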